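/- Fix integers $m\ge 2$ and $\ell\ge 2$. For $n\ge 1$ let $G^m_n$ be the uniform attachment graph: the random multigraph on the vertex set $[n]=\{1,\dots,n\}$ in which every vertex $j\in\{2,\dots,n\}$ has $m$ edges labelled $1,\dots,m$ to vertices with smaller number, the other endpoint of each of these edges being chosen uniformly at random from $[j-1]=\{1,\dots,j-1\}$, all choices being independent (so multiple edges are allowed). Let $W_n$ be the number of $\ell$-cycles in $G^m_n$, that is, the number of subgraphs of the multigraph $G^m_n$ that are cycles with $\ell$ vertices and $\ell$ edges; a pair of parallel edges is a $2$-cycle, and subgraphs with different edge sets are counted separately. Let $\mu_n:=\mathbb{E}W_n$. Then $$\mu_n=\Theta(\log n)\qquad\text{as } n\to\infty,$$ and there is a positive constant $C=C(m,\ell)$ such that for all $n\ge 2$ $$d_{\mathrm{TV}}\bigl(\mathcal{L}(W_n),\mathrm{Po}(\mu_n)\bigr)\le \frac{C}{\log n},$$ where $\mathcal{L}(W_n)$ is the law of $W_n$, $\mathrm{Po}(\mu)$ is the Poisson distribution with mean $\mu$ (the point mass at $0$ if $\mu=0$), and $d_{\mathrm{TV}}(\nu_1,\nu_2)=\sup_{A\subseteq\{0,1,2,\dots\}}|\nu_1(A)-\nu_2(A)|$.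 -/

import Mathlib

open MeasureTheory ProbabilityTheory Filter Asymptotics

namespace UniformAttachment

/-- The `m`-fold complete multigraph on `[n] = {1, …, n}`: for `1 ≤ i < j ≤ n` and every label
`a : Fin m` there is one edge `(j, i, a)`, and it joins `j` and `i`. -/
def completeMultigraph (m n : ℕ) : Graph ℕ (ℕ × ℕ × Fin m) where
  vertexSet := Set.Icc 1 n
  IsLink e x y := (1 ≤ e.2.1 ∧ e.2.1 < e.1 ∧ e.1 ≤ n) ∧
    ((x = e.1 ∧ y = e.2.1) ∨ (x = e.2.1 ∧ y = e.1))
  isLink_symm := fun _ _ => ⟨fun _ _ h => ⟨h.1, h.2.symm.imp And.symm And.symm⟩⟩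
  eq_or_eq_of_isLink_of_isLink := by
    rintro ⟨j, i, a⟩ x y v w ⟨-, h⟩ ⟨-, h'⟩
    simp only at h h'
    omega
  left_mem_of_isLink := by
    rintro ⟨j, i, a⟩ x y ⟨h, h'⟩
    simp only at h h'
    simp only [Set.mem_Icc]
    omega

/-- The sample space: for each vertex `j ∈ {2, …, n}` and each label `a`, the endpoint in
`[j - 1] = {1, …, j - 1}` of the `a`-th edge of `j`. -/
abbrev Choices (m n : ℕ) : Type :=
  (s : Finset.Icc 2 n × Fin m) → Finset.Ico 1 (s.1 : ℕ)

instance nonempty_Ico {n : ℕ} (j : Finset.Icc 2 n) : Nonempty (Finset.Ico 1 (j : ℕ)) :=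
  ⟨⟨1, Finset.mem_Ico.2 ⟨le_rfl, (Finset.mem_Icc.1 j.2).1⟩⟩⟩

/-- All endpoints are chosen independently, the one of an edge of `j` uniformly on `[j - 1]`. -/
noncomputable def choiceMeasure (m n : ℕ) : Measure (Choices m n) :=
  Measure.pi fun s => uniformOn (Set.univ : Set (Finset.Ico 1 (s.1 : ℕ)))

instance (m n : ℕ) : IsProbabilityMeasure (choiceMeasure m n) := by
  unfold choiceMeasure; infer_instance

/-- The uniform attachment graph `G^m_n` given by the choices `ω`: the spanning subgraph of the
`m`-fold complete multigraph whose edges are the chosen ones. -/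
def attachmentGraph {m n : ℕ} (ω : Choices m n) : Graph ℕ (ℕ × ℕ × Fin m) :=
  (completeMultigraph m n).restrict
    (Set.range fun s : Finset.Icc 2 n × Fin m => ((s.1 : ℕ), (ω s : ℕ), s.2))

/-- The multigraph `H` is an `ℓ`-cycle (`ℓ ≥ 2`): it consists of `ℓ` distinct vertices `v i` and
`ℓ` distinct edges `e i`, indexed cyclically, with `e i` joining `v i` and `v (i + 1)`.
For `ℓ = 2` this is a pair of parallel edges. -/
def IsCycleGraph {α β : Type*} (ℓ : ℕ) (H : Graph α β) : Prop :=
  ∃ (v : ZMod ℓ → α) (e : ZMod ℓ → β), Function.Injective v ∧ Function.Injective e ∧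
    H.vertexSet = Set.range v ∧ H.edgeSet = Set.range e ∧ ∀ i, H.IsLink (e i) (v i) (v (i + 1))

/-- `W_n`, the number of subgraphs of `G^m_n` that are `ℓ`-cycles. -/
noncomputable def cycleCount (m ℓ n : ℕ) (ω : Choices m n) : ℕ :=
  {H : Graph ℕ (ℕ × ℕ × Fin m) | H ≤ attachmentGraph ω ∧ IsCycleGraph ℓ H}.ncard

theorem measurable_cycleCount (m ℓ n : ℕ) : Measurable (cycleCount m ℓ n) :=
  Measurable.of_discrete

/-- The law of `W_n`. -/
noncomputable def cycleLaw (m ℓ n : ℕ) : Measure ℕ :=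
  (choiceMeasure m n).map (cycleCount m ℓ n)

/-- `μ_n = E W_n`. -/
noncomputable def cycleMean (m ℓ n : ℕ) : ℝ :=
  ∫ ω, (cycleCount m ℓ n ω : ℝ) ∂(choiceMeasure m n)

/-- Since the sample space is finite, the expectation `μ_n` is that of an integrable variable. -/
theorem integrable_cycleCount (m ℓ n : ℕ) :
    Integrable (fun ω => (cycleCount m ℓ n ω : ℝ)) (choiceMeasure m n) :=
  Integrable.of_finite

theorem cycleMean_nonneg (m ℓ n : ℕ) : 0 ≤ cycleMean m ℓ n :=
  integral_nonneg fun _ => Nat.cast_nonneg _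

/-- Total variation distance of probability measures on `ℕ`: the supremum over all sets `A` of
`|ν₁ A - ν₂ A|` (every subset of `ℕ` is measurable). -/
noncomputable def tvDist (ν₁ ν₂ : Measure ℕ) : ℝ :=
  ⨆ A : Set ℕ, |ν₁.real A - ν₂.real A|

end UniformAttachment

/-! The indicators of the events that a given `ℓ`-cycle of the complete multigraph is present are
dissected by the Chen–Stein method: two of them are independent unless the cycles use a common
choice, so the total variation distance is at most `1 / μ_n` times the sum, over the pairs of
cycles sharing a choice, of `P(E) P(F) + P(E ∩ F)`. This sum is bounded in `n`. Indeed, a cycle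
is present with probability at most the product of `1 / (max (v i) (v (i + 1)) - 1)` over its
edges. Summing over closed walks this is a power of the kernel `1 / max u v`, which maps the
function `1 / √u` to at most a constant multiple of itself. As the closing edge of a walk from `x`
to `u` has weight at most `1 / √(x u)`, the cycles through a given vertex `x` have total weight
`O(1 / x)`, and the pairs of dependent cycles have total weight `O(∑ 1 / x ^ 2)`. The same bound
gives `μ_n = O(∑ 1 / x) = O(log n)`. For the lower bound, visiting an `ℓ`-set with maximum
`k + 1` in increasing order is a cycle of probability at least `k ^ (-ℓ)`, and about
`k ^ (ℓ - 1) / (ℓ - 1)!` sets have that maximum. -/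

namespace UniformAttachment

open scoped NNReal

/-! ### The Stein equation of the Poisson distribution -/

section Stein

theorem measureReal_inter_Iic_succ (μ : Measure ℕ) [IsFiniteMeasure μ] (A : Set ℕ) (k : ℕ) :
    μ.real (A ∩ Set.Iic (k + 1)) =
      μ.real (A ∩ Set.Iic k) + A.indicator 1 (k + 1) * μ.real {k + 1} := by
  have hIic : Set.Iic (k + 1) = insert (k + 1) (Set.Iic k) := Order.Iic_succ k
  by_cases hk : k + 1 ∈ A
  · rw [hIic, Set.inter_insert_of_mem hk, Set.insert_eq, Set.union_comm,
      measureReal_union (by simp) .of_discrete]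
    simp [hk]
  · rw [hIic, Set.inter_insert_of_notMem hk]
    simp [hk]

theorem measureReal_Iic_succ (μ : Measure ℕ) [IsFiniteMeasure μ] (k : ℕ) :
    μ.real (Set.Iic (k + 1)) = μ.real (Set.Iic k) + μ.real {k + 1} := by
  simpa using measureReal_inter_Iic_succ μ Set.univ k

theorem measureReal_inter_Iic_zero (μ : Measure ℕ) (A : Set ℕ) :
    μ.real (A ∩ Set.Iic 0) = A.indicator 1 0 * μ.real {0} := by
  rw [show Set.Iic 0 = {0} from Set.Iic_bot]
  by_cases h : 0 ∈ A <;> simp [h]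

theorem measureReal_Iic_zero (μ : Measure ℕ) : μ.real (Set.Iic 0) = μ.real {0} := by
  simpa using measureReal_inter_Iic_zero μ Set.univ

theorem measureReal_inter_Iic_add_inter_Ioi (μ : Measure ℕ) [IsFiniteMeasure μ] (A : Set ℕ)
    (k : ℕ) : μ.real (A ∩ Set.Iic k) + μ.real (A ∩ Set.Ioi k) = μ.real A := by
  rw [← Set.compl_Iic, ← Set.sdiff_eq]
  exact measureReal_inter_add_sdiff .of_discrete

variable (r : ℝ≥0) (A : Set ℕ) (k : ℕ)

theorem poisson_real_singleton_succ :
    ((k : ℝ) + 1) * Po(r).real {k + 1} = r * Po(r).real {k} := by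
  rw [poissonMeasure_real_singleton, poissonMeasure_real_singleton, Nat.factorial_succ]
  push_cast
  field_simp
  ring

theorem poisson_hasSum_real :
    HasSum (A.indicator fun k => Po(r).real {k}) (Po(r).real A) := by
  have h := hasSum_integral_poissonMeasure (r := r) (f := A.indicator 1)
    ((integrable_const (1 : ℝ)).indicator .of_discrete)
  rw [integral_indicator_one .of_discrete] at h
  convert! h using 1
  ext k
  by_cases hk : k ∈ A <;> simp [hk, poissonMeasure_real_singleton]

theorem poisson_real_Ioi_succ_le :
    ((k : ℝ) + 1) * Po(r).real (Set.Ioi (k + 1)) ≤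
      r * Po(r).real (Set.Ioi k) := by
  have hsucc := (poisson_hasSum_real r (Set.Ioi (k + 1))).mul_left ((k : ℝ) + 1)
  rw [← hasSum_nat_add_iff' 1, Finset.sum_range_one, Set.indicator_of_notMem (by simp), mul_zero,
    sub_zero] at hsucc
  refine hasSum_le (fun i => ?_) hsucc ((poisson_hasSum_real r (Set.Ioi k)).mul_left (r : ℝ))
  by_cases hi : k < i
  · rw [Set.indicator_of_mem (by simpa using hi), Set.indicator_of_mem (by simpa using hi),
      ← poisson_real_singleton_succ]
    gcongr
  · rw [Set.indicator_of_notMem (by simpa using hi), Set.indicator_of_notMem (by simpa using hi),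
      mul_zero, mul_zero]

theorem poisson_real_Iic_le :
    r * Po(r).real (Set.Iic k) ≤
      ((k : ℝ) + 1) * Po(r).real (Set.Iic (k + 1)) := by
  induction k with
  | zero =>
    have h := poisson_real_singleton_succ r 0
    rw [measureReal_Iic_succ, measureReal_Iic_zero]
    push_cast at h ⊢
    linarith [measureReal_nonneg (μ := Po(r)) (s := {0})]
  | succ k ih =>
    have h := poisson_real_singleton_succ r (k + 1)
    rw [measureReal_Iic_succ _ (k + 1), mul_add, h, measureReal_Iic_succ, mul_add]
    rw [measureReal_Iic_succ] at ih
    push_cast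
    nlinarith [measureReal_nonneg (μ := Po(r)) (s := Set.Iic k),
      measureReal_nonneg (μ := Po(r)) (s := {k + 1})]

/-- The covariance of the events `A` and `{0, …, k}` under the Poisson distribution: the numerator
of the solution of the Stein equation. -/
noncomputable def poissonCov (r : ℝ≥0) (A : Set ℕ) (k : ℕ) : ℝ :=
  Po(r).real (A ∩ Set.Iic k) -
    Po(r).real A * Po(r).real (Set.Iic k)

theorem poissonCov_zero :
    poissonCov r A 0 =
      (A.indicator 1 0 - Po(r).real A) * Po(r).real {0} := by
  rw [poissonCov, measureReal_inter_Iic_zero, measureReal_Iic_zero, sub_mul]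

theorem poissonCov_succ :
    poissonCov r A (k + 1) = poissonCov r A k +
      (A.indicator 1 (k + 1) - Po(r).real A) * Po(r).real {k + 1} := by
  rw [poissonCov, poissonCov, measureReal_inter_Iic_succ, measureReal_Iic_succ]
  ring

theorem poissonCov_compl : poissonCov r Aᶜ k = -poissonCov r A k := by
  have h : Po(r).real (A ∩ Set.Iic k) + Po(r).real (Aᶜ ∩ Set.Iic k) =
      Po(r).real (Set.Iic k) := by
    rw [Set.inter_comm A, Set.inter_comm Aᶜ, ← Set.sdiff_eq]
    exact measureReal_inter_add_sdiff .of_discrete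
  rw [poissonCov, poissonCov, probReal_compl_eq_one_sub .of_discrete]
  linear_combination h

theorem poissonCov_succ_sub_le :
    ((k : ℝ) + 1) * poissonCov r A (k + 1) - r * poissonCov r A k ≤
      (k + 1) * Po(r).real {k + 1} := by
  set i : ℝ := A.indicator 1 (k + 1)
  have hi : i ≤ 1 := Set.indicator_le_self' (by simp) _
  have hIoi := poisson_real_Ioi_succ_le r k
  have hIic := poisson_real_Iic_le r k
  have hA := measureReal_inter_Iic_add_inter_Ioi Po(r) A (k + 1)
  rw [measureReal_inter_Iic_succ] at hA
  have htotal (j : ℕ) : Po(r).real (Set.Iic j) + Po(r).real (Set.Ioi j) = 1 := by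
    simpa using measureReal_inter_Iic_add_inter_Ioi Po(r) Set.univ j
  have hsplit : ((k : ℝ) + 1) * poissonCov r A (k + 1) - r * poissonCov r A k =
      Po(r).real (A ∩ Set.Iic k) *
        ((k + 1) * Po(r).real (Set.Ioi (k + 1)) - r * Po(r).real (Set.Ioi k)) -
      Po(r).real (A ∩ Set.Ioi (k + 1)) *
        ((k + 1) * Po(r).real (Set.Iic (k + 1)) - r * Po(r).real (Set.Iic k)) +
      i * Po(r).real {k + 1} *
        ((k + 1) * Po(r).real (Set.Ioi (k + 1)) + r * Po(r).real (Set.Iic k)) := by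
    rw [poissonCov, poissonCov, measureReal_inter_Iic_succ]
    linear_combination ((k + 1) * Po(r).real (Set.Iic (k + 1)) - r * Po(r).real (Set.Iic k)) * hA -
      (k + 1) * (Po(r).real (A ∩ Set.Iic k) + i * Po(r).real {k + 1}) * htotal (k + 1) +
      r * Po(r).real (A ∩ Set.Iic k) * htotal k
  calc _ ≤ 0 - 0 + 1 * Po(r).real {k + 1} *
        ((k + 1) * Po(r).real (Set.Ioi (k + 1)) + (k + 1) * Po(r).real (Set.Iic (k + 1))) := by
        rw [hsplit]
        gcongr
        · exact mul_nonpos_of_nonneg_of_nonpos measureReal_nonneg (sub_nonpos.2 hIoi)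
        · exact mul_nonneg measureReal_nonneg (sub_nonneg.2 hIic)
    _ = (k + 1) * Po(r).real {k + 1} := by
        linear_combination (k + 1) * Po(r).real {k + 1} * htotal (k + 1)

/-- The solution of the Stein equation of the Poisson distribution for the test set `A`. -/
noncomputable def steinSolution (r : ℝ≥0) (A : Set ℕ) : ℕ → ℝ
  | 0 => 0
  | k + 1 => poissonCov r A k / (r * Po(r).real {k})

theorem steinSolution_compl : steinSolution r Aᶜ k = -steinSolution r A k := by
  cases k with
  | zero => simp [steinSolution]
  | succ k => rw [steinSolution, steinSolution, poissonCov_compl, neg_div]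

variable {r}

theorem steinSolution_equation (hr : 0 < r) :
    r * steinSolution r A (k + 1) - k * steinSolution r A k =
      A.indicator 1 k - Po(r).real A := by
  have hp (k : ℕ) : 0 < Po(r).real {k} := poissonMeasure_real_singleton_pos k hr
  have : (0 : ℝ) < r := hr
  cases k with
  | zero =>
    have := hp 0
    rw [steinSolution, steinSolution, poissonCov_zero]
    field_simp
    simp
  | succ k =>
    have := hp k
    have := hp (k + 1)
    rw [steinSolution, steinSolution, poissonCov_succ, ← poisson_real_singleton_succ r k]
    push_cast
    field_simp
    ring

theorem steinSolution_succ_sub_le (hr : 0 < r) :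
    steinSolution r A (k + 2) - steinSolution r A (k + 1) ≤ 1 / r := by
  have hp : 0 < Po(r).real {k + 1} := poissonMeasure_real_singleton_pos _ hr
  have : (0 : ℝ) < r := hr
  calc steinSolution r A (k + 2) - steinSolution r A (k + 1)
      = ((k + 1) * poissonCov r A (k + 1) - r * poissonCov r A k) /
          (r * ((k + 1) * Po(r).real {k + 1})) := by
        rw [steinSolution, steinSolution, ← poisson_real_singleton_succ r k]
        field_simp
    _ ≤ (k + 1) * Po(r).real {k + 1} /
          (r * ((k + 1) * Po(r).real {k + 1})) := by
        gcongr
        exact poissonCov_succ_sub_le r A k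
    _ = 1 / r := by field_simp

theorem abs_steinSolution_succ_sub_le (hr : 0 < r) :
    |steinSolution r A (k + 2) - steinSolution r A (k + 1)| ≤ 1 / r := by
  have h := steinSolution_succ_sub_le Aᶜ k hr
  rw [steinSolution_compl, steinSolution_compl] at h
  exact abs_le.2 ⟨by linarith, steinSolution_succ_sub_le A k hr⟩

theorem abs_steinSolution_add_sub_le (hr : 0 < r) (d : ℕ) :
    |steinSolution r A (k + d + 1) - steinSolution r A (k + 1)| ≤ d / r := by
  have h := dist_le_range_sum_of_dist_le (f := fun j => steinSolution r A (k + j + 1))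
    (d := fun _ => 1 / (r : ℝ)) d fun {j} _ => by
      rw [dist_comm]
      exact abs_steinSolution_succ_sub_le A (k + j) hr
  rw [dist_comm, Real.dist_eq] at h
  simpa [div_eq_mul_inv] using h

end Stein

/-! ### The Stein–Chen method for locally dependent events -/

section SteinChen

variable {Ω ι : Type*} {mΩ : MeasurableSpace Ω} {T : ι → Set Ω} {s : Finset ι} {μ : Measure Ω}

/-- The number of the events `T i`, `i ∈ s`, that occur. -/
noncomputable def eventCount (T : ι → Set Ω) (s : Finset ι) (ω : Ω) : ℕ :=
  ∑ i ∈ s, (T i).indicator 1 ω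

theorem eventCount_le_card (T : ι → Set Ω) (s : Finset ι) (ω : Ω) : eventCount T s ω ≤ s.card :=
  (Finset.sum_le_card_nsmul s _ 1 fun _ _ => Set.indicator_le_self' (by simp) ω).trans (by simp)

theorem eventCount_sdiff_add [DecidableEq ι] {N : Finset ι} (hN : N ⊆ s) (ω : Ω) :
    eventCount T (s \ N) ω + eventCount T N ω = eventCount T s ω :=
  Finset.sum_sdiff hN

theorem one_add_eventCount_erase [DecidableEq ι] {i : ι} (hi : i ∈ s) {ω : Ω} (hω : ω ∈ T i) :
    1 + eventCount T (s.erase i) ω = eventCount T s ω := by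
  rw [eventCount, eventCount, ← Finset.add_sum_erase s _ hi, Set.indicator_of_mem hω, Pi.one_apply]

theorem measurable_eventCount (hT : ∀ i, MeasurableSet (T i)) : Measurable (eventCount T s) :=
  Finset.measurable_fun_sum _ fun i _ => measurable_one.indicator (hT i)

theorem integrable_comp_eventCount [IsFiniteMeasure μ] (hT : ∀ i, MeasurableSet (T i))
    (g : ℕ → ℝ) : Integrable (fun ω => g (eventCount T s ω)) μ := by
  refine .of_bound ((Measurable.of_discrete.comp (measurable_eventCount hT)).aestronglyMeasurable)
    (∑ k ∈ Finset.range (s.card + 1), ‖g k‖) (.of_forall fun ω => ?_)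
  exact Finset.single_le_sum (f := fun k => ‖g k‖) (fun _ _ => norm_nonneg _)
    (Finset.mem_range_succ_iff.2 (eventCount_le_card T s ω))

theorem integral_eventCount_mul (hT : ∀ i, MeasurableSet (T i)) {g : Ω → ℝ}
    (hg : Integrable g μ) :
    ∫ ω, eventCount T s ω * g ω ∂μ = ∑ i ∈ s, ∫ ω in T i, g ω ∂μ := by
  simp_rw [← integral_indicator (hT _)]
  rw [← integral_finsetSum _ fun i _ => hg.indicator (hT i)]
  refine integral_congr_ae (.of_forall fun ω => ?_)
  simp only [eventCount, Nat.cast_sum, Finset.sum_mul]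
  refine Finset.sum_congr rfl fun i _ => ?_
  by_cases hω : ω ∈ T i <;> simp [hω]

theorem integral_eventCount [IsFiniteMeasure μ] (hT : ∀ i, MeasurableSet (T i)) :
    ∫ ω, (eventCount T s ω : ℝ) ∂μ = ∑ i ∈ s, μ.real (T i) := by
  simpa using integral_eventCount_mul (μ := μ) (s := s) hT (integrable_const 1)

theorem setIntegral_comp_eventCount_of_indepFun {i : ι} (hT : ∀ i, MeasurableSet (T i))
    (hind : IndepFun ((T i).indicator (1 : Ω → ℕ)) (eventCount T s) μ) (g : ℕ → ℝ) :
    ∫ ω in T i, g (eventCount T s ω) ∂μ = μ.real (T i) * ∫ ω, g (eventCount T s ω) ∂μ := by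
  have hcomp := hind.integral_fun_comp_mul_comp (f := fun k : ℕ => (k : ℝ)) (g := g)
    (measurable_one.indicator (hT i)).aemeasurable (measurable_eventCount hT).aemeasurable
    Measurable.of_discrete.aestronglyMeasurable Measurable.of_discrete.aestronglyMeasurable
  have hind_eq (ω : Ω) : (((T i).indicator 1 ω : ℕ) : ℝ) = (T i).indicator 1 ω := by
    by_cases hω : ω ∈ T i <;> simp [hω]
  simp only [hind_eq, integral_indicator_one (hT i)] at hcomp
  rw [← hcomp, ← integral_indicator (hT i)]
  refine integral_congr_ae (.of_forall fun ω => ?_)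
  by_cases hω : ω ∈ T i <;> simp [hω]

variable {r : ℝ≥0} {N : Finset ι} {i : ι} [IsProbabilityMeasure μ]

theorem measureReal_eventCount_sub_poisson_real (hT : ∀ i, MeasurableSet (T i)) (hr : 0 < r)
    (hrs : (r : ℝ) = ∑ i ∈ s, μ.real (T i)) (A : Set ℕ) :
    μ.real (eventCount T s ⁻¹' A) - Po(r).real A =
      ∑ i ∈ s, (μ.real (T i) * ∫ ω, steinSolution r A (eventCount T s ω + 1) ∂μ -
        ∫ ω in T i, steinSolution r A (eventCount T s ω) ∂μ) := by
  have hint := integrable_comp_eventCount (s := s) (μ := μ) hT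
  calc μ.real (eventCount T s ⁻¹' A) - Po(r).real A
      = ∫ ω, (A.indicator 1 (eventCount T s ω) - Po(r).real A) ∂μ := by
        rw [integral_sub (hint _) (integrable_const _), integral_const, probReal_univ, one_smul,
          ← integral_indicator_one (measurable_eventCount hT .of_discrete)]
        rfl
    _ = ∫ ω, (r * steinSolution r A (eventCount T s ω + 1) -
          eventCount T s ω * steinSolution r A (eventCount T s ω)) ∂μ := by
        simp_rw [steinSolution_equation A _ hr]
    _ = r * ∫ ω, steinSolution r A (eventCount T s ω + 1) ∂μ -
          ∑ i ∈ s, ∫ ω in T i, steinSolution r A (eventCount T s ω) ∂μ := by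
        rw [integral_sub (hint fun k => r * steinSolution r A (k + 1))
          (hint fun k => k * steinSolution r A k), integral_const_mul,
          integral_eventCount_mul hT (hint _)]
    _ = _ := by rw [hrs, Finset.sum_sub_distrib, Finset.sum_mul]

variable [DecidableEq ι]

theorem abs_integral_steinSolution_sub_le (hT : ∀ i, MeasurableSet (T i)) (hr : 0 < r)
    (hN : N ⊆ s) (A : Set ℕ) :
    |∫ ω, (steinSolution r A (eventCount T s ω + 1) -
      steinSolution r A (eventCount T (s \ N) ω + 1)) ∂μ| ≤ 1 / r * ∑ j ∈ N, μ.real (T j) := by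
  rw [← integral_eventCount hT, ← integral_const_mul, ← Real.norm_eq_abs]
  refine norm_integral_le_of_norm_le
    (integrable_comp_eventCount (μ := μ) (s := N) hT fun k => 1 / (r : ℝ) * k)
    (.of_forall fun ω => ?_)
  rw [← eventCount_sdiff_add hN, Real.norm_eq_abs, one_div_mul_eq_div]
  exact abs_steinSolution_add_sub_le A _ hr _

theorem abs_setIntegral_steinSolution_sub_le (hT : ∀ i, MeasurableSet (T i)) (hr : 0 < r)
    (hN : N ⊆ s) (hi : i ∈ N) (A : Set ℕ) :
    |∫ ω in T i, (steinSolution r A (eventCount T s ω) -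
      steinSolution r A (eventCount T (s \ N) ω + 1)) ∂μ| ≤
      1 / r * ∑ j ∈ N.erase i, μ.real (T i ∩ T j) := by
  simp_rw [Set.inter_comm (T i), ← measureReal_restrict_apply (hT _)]
  rw [← integral_eventCount hT, ← integral_const_mul, ← Real.norm_eq_abs]
  refine norm_integral_le_of_norm_le
    (integrable_comp_eventCount (μ := μ.restrict (T i)) (s := N.erase i) hT fun k =>
      1 / (r : ℝ) * k)
    ((ae_restrict_mem (hT i)).mono fun ω hω => ?_)
  rw [← eventCount_sdiff_add hN, ← one_add_eventCount_erase hi hω, add_left_comm, add_comm 1,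
    Real.norm_eq_abs, one_div_mul_eq_div]
  exact abs_steinSolution_add_sub_le A _ hr _

theorem abs_steinTerm_le (hT : ∀ i, MeasurableSet (T i)) (hr : 0 < r) (hN : N ⊆ s) (hi : i ∈ N)
    (hind : IndepFun ((T i).indicator (1 : Ω → ℕ)) (eventCount T (s \ N)) μ) (A : Set ℕ) :
    |μ.real (T i) * ∫ ω, steinSolution r A (eventCount T s ω + 1) ∂μ -
      ∫ ω in T i, steinSolution r A (eventCount T s ω) ∂μ| ≤
      1 / r * (∑ j ∈ N, μ.real (T i) * μ.real (T j) +
        ∑ j ∈ N.erase i, μ.real (T i ∩ T j)) := by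
  have hint (g : ℕ → ℝ) (u : Finset ι) := integrable_comp_eventCount (μ := μ) (s := u) hT g
  have hind' := setIntegral_comp_eventCount_of_indepFun hT hind fun k => steinSolution r A (k + 1)
  have hsplit : μ.real (T i) * ∫ ω, steinSolution r A (eventCount T s ω + 1) ∂μ -
        ∫ ω in T i, steinSolution r A (eventCount T s ω) ∂μ =
      μ.real (T i) * ∫ ω, (steinSolution r A (eventCount T s ω + 1) -
        steinSolution r A (eventCount T (s \ N) ω + 1)) ∂μ -
      ∫ ω in T i, (steinSolution r A (eventCount T s ω) -
        steinSolution r A (eventCount T (s \ N) ω + 1)) ∂μ := by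
    rw [integral_sub (hint (fun k => steinSolution r A (k + 1)) _)
        (hint (fun k => steinSolution r A (k + 1)) _),
      integral_sub (hint _ _).integrableOn
        (hint (fun k => steinSolution r A (k + 1)) _).integrableOn, hind']
    ring
  rw [hsplit, mul_add, ← Finset.mul_sum, mul_left_comm]
  refine (abs_sub _ _).trans
    (add_le_add ?_ (abs_setIntegral_steinSolution_sub_le hT hr hN hi A))
  rw [abs_mul, abs_of_nonneg measureReal_nonneg]
  exact mul_le_mul_of_nonneg_left (abs_integral_steinSolution_sub_le hT hr hN A) measureReal_nonneg

theorem abs_measureReal_eventCount_sub_poisson_real_le {N : ι → Finset ι}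
    (hT : ∀ i, MeasurableSet (T i)) (hN : ∀ i ∈ s, N i ⊆ s) (hi : ∀ i ∈ s, i ∈ N i)
    (hind : ∀ i ∈ s, IndepFun ((T i).indicator (1 : Ω → ℕ)) (eventCount T (s \ N i)) μ)
    (hr : 0 < r) (hrs : (r : ℝ) = ∑ i ∈ s, μ.real (T i)) (A : Set ℕ) :
    |μ.real (eventCount T s ⁻¹' A) - Po(r).real A| ≤
      1 / r * ∑ i ∈ s, (∑ j ∈ N i, μ.real (T i) * μ.real (T j) +
        ∑ j ∈ (N i).erase i, μ.real (T i ∩ T j)) := by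
  rw [measureReal_eventCount_sub_poisson_real hT hr hrs, Finset.mul_sum]
  exact (Finset.abs_sum_le_sum_abs _ _).trans <| Finset.sum_le_sum fun i his =>
    abs_steinTerm_le hT hr (hN i his) (hi i his) (hind i his) A

end SteinChen

/-! ### Closed walks weighted by the kernel `1 / max u v` -/

section Kernel

theorem inv_sqrt_add_one_le (n : ℕ) : (√(n + 1 : ℝ))⁻¹ ≤ 2 * (√(n + 1 : ℝ) - √n) := by
  have hpos : 0 < √(n + 1 : ℝ) := by positivity
  have hn : √(n : ℝ) ^ 2 = n := Real.sq_sqrt (by positivity)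
  have hsucc : √(n + 1 : ℝ) ^ 2 = n + 1 := Real.sq_sqrt (by positivity)
  rw [inv_le_iff_one_le_mul₀ hpos]
  nlinarith [sq_nonneg (√(n + 1 : ℝ) - √n)]

theorem sum_inv_sqrt_le (n : ℕ) : ∑ v ∈ Finset.Icc 1 n, (√(v : ℝ))⁻¹ ≤ 2 * √(n : ℝ) := by
  induction n with
  | zero => simp
  | succ n ih =>
    rw [Finset.sum_Icc_succ_top (by lia)]
    have := inv_sqrt_add_one_le n
    push_cast
    linarith

theorem inv_mul_inv_sqrt_add_one_le {n : ℕ} (hn : 1 ≤ n) :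
    (n + 1 : ℝ)⁻¹ * (√(n + 1 : ℝ))⁻¹ ≤ 2 * (√(n : ℝ))⁻¹ - 2 * (√(n + 1 : ℝ))⁻¹ := by
  have : 0 < √(n : ℝ) := Real.sqrt_pos.2 (by positivity)
  have hle : √(n : ℝ) ≤ √(n + 1 : ℝ) := Real.sqrt_le_sqrt (by linarith)
  calc (n + 1 : ℝ)⁻¹ * (√(n + 1 : ℝ))⁻¹
      = (√(n + 1 : ℝ))⁻¹ * (√(n + 1 : ℝ))⁻¹ * (√(n + 1 : ℝ))⁻¹ := by
        rw [← mul_inv (√(n + 1 : ℝ)), Real.mul_self_sqrt (by positivity)]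
    _ ≤ 2 * (√(n + 1 : ℝ) - √n) * (√(n : ℝ))⁻¹ * (√(n + 1 : ℝ))⁻¹ := by
        gcongr
        exact inv_sqrt_add_one_le n
    _ = 2 * (√(n : ℝ))⁻¹ - 2 * (√(n + 1 : ℝ))⁻¹ := by field_simp

theorem sum_Ioc_inv_mul_inv_sqrt_le {u : ℕ} (hu : 1 ≤ u) (n : ℕ) :
    ∑ v ∈ Finset.Ioc u n, (v : ℝ)⁻¹ * (√(v : ℝ))⁻¹ ≤ 2 * (√(u : ℝ))⁻¹ := by
  rcases le_total n u with hnu | hun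
  · simp [Finset.Ioc_eq_empty_of_le hnu]
  suffices ∑ v ∈ Finset.Ioc u n, (v : ℝ)⁻¹ * (√(v : ℝ))⁻¹ ≤
      2 * (√(u : ℝ))⁻¹ - 2 * (√(n : ℝ))⁻¹ from this.trans (sub_le_self _ (by positivity))
  induction n, hun using Nat.le_induction with
  | base => simp
  | succ n hun ih =>
    have := inv_mul_inv_sqrt_add_one_le (hu.trans hun)
    rw [← Finset.insert_Ioc_right_eq_Ioc_add_one hun, Finset.sum_insert (by simp)]
    push_cast
    linarith

theorem sum_inv_max_mul_inv_sqrt_le {u : ℕ} (hu : 1 ≤ u) (n : ℕ) :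
    ∑ v ∈ Finset.Icc 1 n, (max (u : ℝ) v)⁻¹ * (√(v : ℝ))⁻¹ ≤ 4 * (√(u : ℝ))⁻¹ := by
  have hsub : Finset.Icc 1 n ⊆ Finset.Icc 1 u ∪ Finset.Ioc u n := fun v => by
    simp only [Finset.mem_union, Finset.mem_Icc, Finset.mem_Ioc]
    lia
  have hdisj : Disjoint (Finset.Icc 1 u) (Finset.Ioc u n) :=
    Finset.disjoint_left.2 fun v => by
      simp only [Finset.mem_Icc, Finset.mem_Ioc]
      lia
  have hlow : ∑ v ∈ Finset.Icc 1 u, (max (u : ℝ) v)⁻¹ * (√(v : ℝ))⁻¹ ≤ 2 * (√(u : ℝ))⁻¹ :=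
    calc ∑ v ∈ Finset.Icc 1 u, (max (u : ℝ) v)⁻¹ * (√(v : ℝ))⁻¹
        = (u : ℝ)⁻¹ * ∑ v ∈ Finset.Icc 1 u, (√(v : ℝ))⁻¹ := by
          rw [Finset.mul_sum]
          refine Finset.sum_congr rfl fun v hv => ?_
          rw [max_eq_left (Nat.cast_le.2 (Finset.mem_Icc.1 hv).2)]
      _ ≤ (√(u : ℝ) * √u)⁻¹ * (2 * √(u : ℝ)) := by
          rw [Real.mul_self_sqrt (by positivity)]
          gcongr
          exact sum_inv_sqrt_le u
      _ = 2 * (√(u : ℝ))⁻¹ := by field_simp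
  have hhigh : ∑ v ∈ Finset.Ioc u n, (max (u : ℝ) v)⁻¹ * (√(v : ℝ))⁻¹ ≤ 2 * (√(u : ℝ))⁻¹ := by
    refine le_of_eq_of_le (Finset.sum_congr rfl fun v hv => ?_) (sum_Ioc_inv_mul_inv_sqrt_le hu n)
    rw [max_eq_right (Nat.cast_le.2 (Finset.mem_Ioc.1 hv).1.le)]
  refine (Finset.sum_le_sum_of_subset_of_nonneg hsub fun _ _ _ => by positivity).trans ?_
  rw [Finset.sum_union hdisj]
  linarith

theorem inv_max_le {u v : ℕ} (hu : 1 ≤ u) (hv : 1 ≤ v) :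
    (max (u : ℝ) v)⁻¹ ≤ (√(u : ℝ))⁻¹ * (√(v : ℝ))⁻¹ := by
  have : 0 < √(u : ℝ) := Real.sqrt_pos.2 (by positivity)
  have : 0 < √(v : ℝ) := Real.sqrt_pos.2 (by positivity)
  rw [← mul_inv]
  refine inv_anti₀ (by positivity) ?_
  calc √(u : ℝ) * √(v : ℝ) ≤ √(max u v : ℝ) * √(max u v : ℝ) := by
        gcongr
        exacts [le_max_left _ _, le_max_right _ _]
    _ = max (u : ℝ) v := Real.mul_self_sqrt (by positivity)

theorem sum_piFinset_succ {V M : Type*} [AddCommMonoid M] (s : Finset V) (r : ℕ)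
    (F : (Fin (r + 1) → V) → M) :
    ∑ w ∈ Fintype.piFinset fun _ : Fin (r + 1) => s, F w =
      ∑ x ∈ s, ∑ w ∈ Fintype.piFinset fun _ : Fin r => s, F (Fin.cons x w) := by
  rw [← Finset.sum_product']
  refine Finset.sum_equiv (Fin.consEquiv fun _ => V).symm (fun w => ?_) fun w _ => ?_
  · simp [Fintype.mem_piFinset, Fin.forall_fin_succ (n := r), Fin.tail]
  · simp

theorem sum_walk_le {V : Type*} {s : Finset V} {K : V → V → ℝ} {g : V → ℝ} {C : ℝ}
    (hK : ∀ u ∈ s, ∀ v ∈ s, 0 ≤ K u v) (hC : 0 ≤ C)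
    (hg : ∀ u ∈ s, ∑ v ∈ s, K u v * g v ≤ C * g u) (r : ℕ) {p : V → ℝ} (hp : ∀ u ∈ s, 0 ≤ p u) :
    ∑ w ∈ Fintype.piFinset fun _ : Fin (r + 1) => s,
        p (w 0) * (∏ i : Fin r, K (w i.castSucc) (w i.succ)) * g (w (Fin.last r)) ≤
      C ^ r * ∑ x ∈ s, p x * g x := by
  induction r generalizing p with
  | zero => simp [sum_piFinset_succ]
  | succ r ih =>
    calc _ = ∑ w ∈ Fintype.piFinset fun _ : Fin (r + 1) => s, (∑ x ∈ s, p x * K x (w 0)) *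
          (∏ i : Fin r, K (w i.castSucc) (w i.succ)) * g (w (Fin.last r)) := by
          rw [sum_piFinset_succ, Finset.sum_comm]
          refine Finset.sum_congr rfl fun w _ => ?_
          rw [Finset.sum_mul, Finset.sum_mul]
          refine Finset.sum_congr rfl fun x _ => ?_
          rw [Fin.prod_univ_succ, ← Fin.succ_last]
          simp only [Fin.cons_zero, Fin.cons_succ, Fin.castSucc_zero, Fin.castSucc_succ, mul_assoc]
      _ ≤ C ^ r * ∑ y ∈ s, (∑ x ∈ s, p x * K x y) * g y :=
          ih fun y hy => Finset.sum_nonneg fun x hx => mul_nonneg (hp x hx) (hK x hx y hy)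
      _ = C ^ r * ∑ x ∈ s, p x * ∑ y ∈ s, K x y * g y := by
          simp_rw [Finset.sum_mul, Finset.mul_sum]
          rw [Finset.sum_comm]
          simp_rw [mul_assoc]
      _ ≤ C ^ r * ∑ x ∈ s, p x * (C * g x) := by
          gcongr with x hx
          exacts [hp x hx, hg x hx]
      _ = C ^ (r + 1) * ∑ x ∈ s, p x * g x := by
          simp_rw [mul_left_comm _ C]
          rw [← Finset.mul_sum, pow_succ, mul_assoc]

/-- The kernel of a walk whose steps either follow an edge, of weight comparable to `1 / max u v`,
or move freely inside `A`. -/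
noncomputable def walkKernel (A : Finset ℕ) (u v : ℕ) : ℝ :=
  2 * (max (u : ℝ) v)⁻¹ + if u ∈ A ∧ v ∈ A then 1 else 0

/-- The weight for the Schur test of `walkKernel A`. -/
noncomputable def schurWeight (A : Finset ℕ) (u : ℕ) : ℝ :=
  (√(u : ℝ))⁻¹ + if u ∈ A then ∑ x ∈ A, (√(x : ℝ))⁻¹ else 0

variable {A : Finset ℕ} {n : ℕ}

theorem walkKernel_nonneg (A : Finset ℕ) (u v : ℕ) : 0 ≤ walkKernel A u v := by
  unfold walkKernel; positivity

theorem inv_sqrt_le_schurWeight (A : Finset ℕ) (u : ℕ) : (√(u : ℝ))⁻¹ ≤ schurWeight A u :=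
  le_add_of_nonneg_right (by positivity)

theorem sum_inv_sqrt_le_card (A : Finset ℕ) : ∑ x ∈ A, (√(x : ℝ))⁻¹ ≤ A.card := by
  have hle (x : ℕ) : (√(x : ℝ))⁻¹ ≤ 1 := by
    rcases Nat.eq_zero_or_pos x with rfl | hx
    · simp
    · exact inv_le_one_of_one_le₀ (Real.one_le_sqrt.2 (Nat.one_le_cast.2 hx))
  simpa using Finset.sum_le_card_nsmul A _ 1 fun x _ => hle x

theorem sq_sum_inv_sqrt_le (A : Finset ℕ) :
    (∑ x ∈ A, (√(x : ℝ))⁻¹) ^ 2 ≤ A.card * ∑ x ∈ A, (x : ℝ)⁻¹ := by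
  simpa [Real.sq_sqrt] using sq_sum_le_card_mul_sum_sq (s := A) (f := fun x => (√(x : ℝ))⁻¹)

theorem sum_ite_mem_of_subset {s : Finset ℕ} (hA : A ⊆ s) (F : ℕ → ℝ) :
    ∑ v ∈ s, (if v ∈ A then F v else 0) = ∑ v ∈ A, F v := by
  rw [← Finset.sum_filter, Finset.filter_mem_eq_inter, Finset.inter_eq_right.2 hA]

theorem sum_inv_max_mul_schurWeight_le (hA : A ⊆ Finset.Icc 1 n) {u : ℕ} (hu : 1 ≤ u) :
    ∑ v ∈ Finset.Icc 1 n, (max (u : ℝ) v)⁻¹ * schurWeight A v ≤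
      (4 + (A.card : ℝ) ^ 2) * (√(u : ℝ))⁻¹ := by
  set S := ∑ x ∈ A, (√(x : ℝ))⁻¹
  have hfree : ∑ v ∈ A, (max (u : ℝ) v)⁻¹ * S ≤ (A.card : ℝ) ^ 2 * (√(u : ℝ))⁻¹ :=
    calc ∑ v ∈ A, (max (u : ℝ) v)⁻¹ * S ≤ ∑ v ∈ A, (√(u : ℝ))⁻¹ * (√(v : ℝ))⁻¹ * S := by
          gcongr with v hv
          exact inv_max_le hu (Finset.mem_Icc.1 (hA hv)).1
      _ = S ^ 2 * (√(u : ℝ))⁻¹ := by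
          rw [← Finset.sum_mul, ← Finset.mul_sum]
          ring
      _ ≤ (A.card : ℝ) ^ 2 * (√(u : ℝ))⁻¹ := by
          gcongr
          exact sum_inv_sqrt_le_card A
  simp_rw [schurWeight, mul_add, mul_ite, mul_zero]
  rw [Finset.sum_add_distrib, sum_ite_mem_of_subset hA, add_mul]
  exact add_le_add (sum_inv_max_mul_inv_sqrt_le hu n) hfree

theorem sum_ite_mul_schurWeight (hA : A ⊆ Finset.Icc 1 n) (u : ℕ) :
    ∑ v ∈ Finset.Icc 1 n, (if u ∈ A ∧ v ∈ A then 1 else 0) * schurWeight A v =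
      (1 + A.card) * if u ∈ A then ∑ x ∈ A, (√(x : ℝ))⁻¹ else 0 := by
  by_cases hu : u ∈ A
  · simp only [hu, true_and, ite_mul, one_mul, zero_mul, if_true]
    rw [sum_ite_mem_of_subset hA]
    simp_rw [schurWeight]
    rw [Finset.sum_add_distrib, Finset.sum_ite_mem, Finset.inter_self, Finset.sum_const,
      nsmul_eq_mul, add_mul, one_mul]
  · simp [hu]

theorem sum_walkKernel_mul_schurWeight_le (hA : A ⊆ Finset.Icc 1 n) {u : ℕ} (hu : 1 ≤ u) :
    ∑ v ∈ Finset.Icc 1 n, walkKernel A u v * schurWeight A v ≤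
      (9 + 2 * (A.card : ℝ) ^ 2 + A.card) * schurWeight A u := by
  calc ∑ v ∈ Finset.Icc 1 n, walkKernel A u v * schurWeight A v
      ≤ 2 * ((4 + (A.card : ℝ) ^ 2) * (√(u : ℝ))⁻¹) +
          (1 + A.card) * if u ∈ A then ∑ x ∈ A, (√(x : ℝ))⁻¹ else 0 := by
        simp_rw [walkKernel, add_mul _ _ (schurWeight A _), mul_assoc]
        rw [Finset.sum_add_distrib, ← Finset.mul_sum, sum_ite_mul_schurWeight hA]
        gcongr
        exact sum_inv_max_mul_schurWeight_le hA hu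
    _ = (8 + 2 * (A.card : ℝ) ^ 2) * (√(u : ℝ))⁻¹ +
          (1 + A.card) * if u ∈ A then ∑ x ∈ A, (√(x : ℝ))⁻¹ else 0 := by ring
    _ ≤ (9 + 2 * (A.card : ℝ) ^ 2 + A.card) * (√(u : ℝ))⁻¹ +
          (9 + 2 * (A.card : ℝ) ^ 2 + A.card) *
            if u ∈ A then ∑ x ∈ A, (√(x : ℝ))⁻¹ else 0 := by
        gcongr ?_ * _ + ?_ * _ <;> nlinarith [Nat.cast_nonneg (α := ℝ) A.card]
    _ = (9 + 2 * (A.card : ℝ) ^ 2 + A.card) * schurWeight A u := by rw [schurWeight, mul_add]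

theorem sum_inv_sqrt_mul_schurWeight_le (A : Finset ℕ) :
    ∑ x ∈ A, (√(x : ℝ))⁻¹ * schurWeight A x ≤ (1 + A.card) * ∑ x ∈ A, (x : ℝ)⁻¹ := by
  have hx (x : ℕ) : (√(x : ℝ))⁻¹ * (√(x : ℝ))⁻¹ = (x : ℝ)⁻¹ := by
    rw [← mul_inv, Real.mul_self_sqrt (by positivity)]
  calc ∑ x ∈ A, (√(x : ℝ))⁻¹ * schurWeight A x
      = ∑ x ∈ A, (x : ℝ)⁻¹ + (∑ x ∈ A, (√(x : ℝ))⁻¹) ^ 2 := by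
        simp_rw [schurWeight, mul_add, mul_ite, mul_zero, hx]
        rw [Finset.sum_add_distrib, sum_ite_mem_of_subset subset_rfl, sq, Finset.sum_mul]
    _ ≤ ∑ x ∈ A, (x : ℝ)⁻¹ + A.card * ∑ x ∈ A, (x : ℝ)⁻¹ := by
        gcongr
        exact sq_sum_inv_sqrt_le A
    _ = (1 + A.card) * ∑ x ∈ A, (x : ℝ)⁻¹ := by ring

theorem sum_closed_walk_le (hA : A ⊆ Finset.Icc 1 n) (r : ℕ) :
    ∑ w ∈ Fintype.piFinset fun _ : Fin (r + 1) => Finset.Icc 1 n, (if w 0 ∈ A then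
        (∏ i : Fin r, walkKernel A (w i.castSucc) (w i.succ)) *
          (2 * (max (w (Fin.last r) : ℝ) (w 0))⁻¹) else 0) ≤
      2 * (9 + 2 * (A.card : ℝ) ^ 2 + A.card) ^ r * (1 + A.card) * ∑ x ∈ A, (x : ℝ)⁻¹ := by
  have hwalk := sum_walk_le (s := Finset.Icc 1 n) (K := walkKernel A) (g := schurWeight A)
    (fun _ _ _ _ => walkKernel_nonneg A _ _) (by positivity)
    (fun u hu => sum_walkKernel_mul_schurWeight_le hA (Finset.mem_Icc.1 hu).1) r
    (p := fun x => if x ∈ A then 2 * (√(x : ℝ))⁻¹ else 0) fun _ _ => by positivity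
  calc _ ≤ _ := Finset.sum_le_sum fun w hw => ?_
    _ ≤ _ := hwalk
    _ = 2 * (9 + 2 * (A.card : ℝ) ^ 2 + A.card) ^ r *
          ∑ x ∈ A, (√(x : ℝ))⁻¹ * schurWeight A x := by
        simp_rw [ite_mul, zero_mul]
        rw [sum_ite_mem_of_subset hA, mul_comm 2 (_ ^ r), mul_assoc (_ ^ r), Finset.mul_sum _ _ 2]
        simp_rw [mul_assoc]
    _ ≤ _ := by
        rw [mul_assoc (_ * _ ^ r)]
        gcongr
        exact sum_inv_sqrt_mul_schurWeight_le A
  have hmem (i : Fin (r + 1)) : 1 ≤ w i := (Finset.mem_Icc.1 (Fintype.mem_piFinset.1 hw i)).1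
  have hprod := Finset.prod_nonneg (s := Finset.univ) fun (i : Fin r) _ =>
    walkKernel_nonneg A (w i.castSucc) (w i.succ)
  split_ifs
  · calc _ ≤ (∏ i : Fin r, walkKernel A (w i.castSucc) (w i.succ)) *
          (2 * (schurWeight A (w (Fin.last r)) * (√(w 0 : ℝ))⁻¹)) := by
          gcongr
          refine (inv_max_le (hmem _) (hmem 0)).trans ?_
          gcongr
          exact inv_sqrt_le_schurWeight A _
      _ = _ := by ring
  · simp

end Kernel

/-! ### Cycle subgraphs of a multigraph -/

theorem image_univ_add_right {M β : Type*} [AddGroup M] [Fintype M] [DecidableEq β] (f : M → β)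
    (a : M) : Finset.univ.image (fun x => f (x + a)) = Finset.univ.image f := by
  ext y
  simp only [Finset.mem_image, Finset.mem_univ, true_and]
  exact ((Equiv.addRight a).surjective.exists (p := fun x => f x = y)).symm

section CyclicWalk

variable {α β : Type*} {r : ℕ} {G H : Graph α β} {v : Fin (r + 1) → α} {e : Fin (r + 1) → β}

/-- The closed walk `v 0, e 0, v 1, e 1, …, v r, e r, v 0` in `G` repeats no vertex and no edge.
The indices are added cyclically, in `Fin (r + 1)`. -/
structure IsCyclicWalk (G : Graph α β) (v : Fin (r + 1) → α) (e : Fin (r + 1) → β) : Prop where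
  injective_vertex : Function.Injective v
  injective_edge : Function.Injective e
  isLink (i : Fin (r + 1)) : G.IsLink (e i) (v i) (v (i + 1))

theorem IsCyclicWalk.rotate (h : IsCyclicWalk G v e) (k : Fin (r + 1)) :
    IsCyclicWalk G (fun i => v (i + k)) fun i => e (i + k) where
  injective_vertex := h.injective_vertex.comp (add_left_injective k)
  injective_edge := h.injective_edge.comp (add_left_injective k)
  isLink i := by simpa only [add_right_comm i 1 k] using h.isLink (i + k)

theorem IsCyclicWalk.mono (h : IsCyclicWalk H v e) (hle : H ≤ G) : IsCyclicWalk G v e :=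
  ⟨h.injective_vertex, h.injective_edge, fun i => hle.isLink_mono (h.isLink i)⟩

theorem isCycleGraph_succ_iff :
    IsCycleGraph (r + 1) H ↔ ∃ (v : Fin (r + 1) → α) (e : Fin (r + 1) → β),
      IsCyclicWalk H v e ∧ H.vertexSet = Set.range v ∧ H.edgeSet = Set.range e :=
  ⟨fun ⟨v, e, hv, he, hV, hE, hl⟩ => ⟨v, e, ⟨hv, he, hl⟩, hV, hE⟩,
    fun ⟨v, e, ⟨hv, he, hl⟩, hV, hE⟩ => ⟨v, e, hv, he, hV, hE, hl⟩⟩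

theorem IsCycleGraph.mem_vertexSet_iff (hH : IsCycleGraph (r + 1) H) (hle : H ≤ G) (x : α) :
    x ∈ H.vertexSet ↔ ∃ f ∈ H.edgeSet, ∃ y, G.IsLink f x y := by
  obtain ⟨v, e, h, hV, -⟩ := isCycleGraph_succ_iff.1 hH
  constructor
  · rw [hV]
    rintro ⟨i, rfl⟩
    exact ⟨e i, (h.isLink i).edge_mem, _, hle.isLink_mono (h.isLink i)⟩
  · rintro ⟨f, hf, y, hy⟩
    obtain ⟨a, b, hab⟩ := H.exists_isLink_of_mem_edgeSet hf
    rcases hy.left_eq_or_eq (hle.isLink_mono hab) with rfl | rfl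
    exacts [hab.left_mem, hab.right_mem]

theorem injOn_edgeSet_cycleSubgraphs (G : Graph α β) (r : ℕ) :
    Set.InjOn Graph.edgeSet {H | H ≤ G ∧ IsCycleGraph (r + 1) H} := by
  rintro H₁ ⟨hle₁, hc₁⟩ H₂ ⟨hle₂, hc₂⟩ hE
  refine Graph.Compatible.ext (Set.ext fun x => ?_) hE (.of_le_le hle₁ hle₂)
  rw [hc₁.mem_vertexSet_iff hle₁, hc₂.mem_vertexSet_iff hle₂, hE]

theorem IsCyclicWalk.exists_isCycleGraph (h : IsCyclicWalk G v e) :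
    ∃ H ≤ G, IsCycleGraph (r + 1) H ∧ H.edgeSet = Set.range e := by
  let H := (G.restrict (Set.range e)).induce (Set.range v)
  have hlink (i : Fin (r + 1)) : H.IsLink (e i) (v i) (v (i + 1)) :=
    ⟨⟨⟨i, rfl⟩, h.isLink i⟩, ⟨i, rfl⟩, ⟨i + 1, rfl⟩⟩
  have hE : H.edgeSet = Set.range e := by
    refine Set.Subset.antisymm (fun f hf => ?_) (Set.range_subset_iff.2 fun i => (hlink i).edge_mem)
    obtain ⟨x, y, hxy⟩ := H.exists_isLink_of_mem_edgeSet hf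
    exact hxy.1.1
  refine ⟨H, (Graph.induce_le ?_).trans Graph.restrict_le, isCycleGraph_succ_iff.2
    ⟨v, e, ⟨h.injective_vertex, h.injective_edge, hlink⟩, rfl, hE⟩, hE⟩
  exact Set.range_subset_iff.2 fun i => (h.isLink i).left_mem

theorem ncard_cycleSubgraphs (G : Graph α β) (r : ℕ) :
    {H | H ≤ G ∧ IsCycleGraph (r + 1) H}.ncard =
      {F : Set β | ∃ (v : Fin (r + 1) → α) (e : Fin (r + 1) → β),
        IsCyclicWalk G v e ∧ Set.range e = F}.ncard := by
  rw [← (injOn_edgeSet_cycleSubgraphs G r).ncard_image]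
  congr 1 with F
  constructor
  · rintro ⟨H, ⟨hle, hc⟩, rfl⟩
    obtain ⟨v, e, h, -, hE⟩ := isCycleGraph_succ_iff.1 hc
    exact ⟨v, e, h.mono hle, hE.symm⟩
  · rintro ⟨v, e, h, rfl⟩
    obtain ⟨H, hle, hc, hE⟩ := h.exists_isCycleGraph
    exact ⟨H, ⟨hle, hc⟩, hE⟩

theorem exists_and_not_sub_one {p : Fin (r + 1) → Prop} {i k : Fin (r + 1)} (hi : p i)
    (hk : ¬p k) : ∃ j, p j ∧ ¬p (j - 1) := by
  by_contra! hclosed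
  have hsub (d : Fin (r + 1)) : p (i - d) := by
    induction d using Fin.induction with
    | zero => rwa [sub_zero]
    | succ d ih => rw [← Fin.coeSucc_eq_succ, ← sub_sub]; exact hclosed _ ih
  exact hk (by simpa only [sub_sub_cancel] using hsub (i - k))

end CyclicWalk

/-! ### The events that all edges of a given set are chosen -/

theorem indepFun_pi_of_dependsOn {ι β γ : Type*} [Fintype ι] {X : ι → Type*}
    [∀ i, MeasurableSpace (X i)] {μ : ∀ i, Measure (X i)} [∀ i, IsProbabilityMeasure (μ i)]
    [MeasurableSpace β] [MeasurableSpace γ] {f : (∀ i, X i) → β} {g : (∀ i, X i) → γ}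
    {S T : Finset ι} (hf : Measurable f) (hg : Measurable g) (hfS : DependsOn f S)
    (hgT : DependsOn g T) (hST : Disjoint S T) : IndepFun f g (Measure.pi μ) := by
  classical
  have hne (i : ι) : Nonempty (X i) := nonempty_of_isProbabilityMeasure (μ i)
  let x₀ (i : ι) : X i := (hne i).some
  have hagree (U : Finset ι) (x : ∀ i, X i) :
      ∀ i ∈ (U : Set ι), Function.updateFinset x₀ U (fun i => x i) i = x i := fun i hi => by
    simp [Function.updateFinset, Finset.mem_coe.1 hi]
  have hcoord : iIndepFun (fun (i : ι) (x : ∀ i, X i) => x i) (Measure.pi μ) :=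
    iIndepFun_pi (X := fun _ y => y) fun _ => aemeasurable_id
  have hrestrict := hcoord.indepFun_finset S T hST measurable_pi_apply
  have hf' : (f ∘ Function.updateFinset x₀ S) ∘ (fun x (i : S) => x i) = f :=
    funext fun x => hfS (hagree S x)
  have hg' : (g ∘ Function.updateFinset x₀ T) ∘ (fun x (i : T) => x i) = g :=
    funext fun x => hgT (hagree T x)
  rw [← hf', ← hg']
  exact hrestrict.comp (hf.comp measurable_updateFinset) (hg.comp measurable_updateFinset)

section Present

variable {m n : ℕ} {e : ℕ × ℕ × Fin m} {E F : Finset (ℕ × ℕ × Fin m)}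

/-- The choice that decides whether the edge `(j, i, a)` is present: the `a`-th one of `j`. -/
def slot (e : ℕ × ℕ × Fin m) : ℕ × Fin m := (e.1, e.2.2)

/-- The event that all edges in `E` are edges of the attachment graph. -/
def presentEvent (n : ℕ) (E : Finset (ℕ × ℕ × Fin m)) : Set (Choices m n) :=
  {ω | ↑E ⊆ (attachmentGraph ω).edgeSet}

/-- The probability of `presentEvent n E` when the edges in `E` have distinct slots: the vertex
`j` has `j - 1` equally likely targets. -/
noncomputable def edgeWeight (E : Finset (ℕ × ℕ × Fin m)) : ℝ :=
  ∏ e ∈ E, ((e.1 - 1 : ℕ) : ℝ)⁻¹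

theorem edgeWeight_nonneg (E : Finset (ℕ × ℕ × Fin m)) : 0 ≤ edgeWeight E :=
  Finset.prod_nonneg fun _ _ => by positivity

theorem mem_edgeSet_completeMultigraph :
    e ∈ (completeMultigraph m n).edgeSet ↔ 1 ≤ e.2.1 ∧ e.2.1 < e.1 ∧ e.1 ≤ n :=
  ⟨fun ⟨_, _, h⟩ => h.1, fun h => ⟨_, _, h, .inl ⟨rfl, rfl⟩⟩⟩

theorem mem_edgeSet_attachmentGraph {ω : Choices m n} :
    e ∈ (attachmentGraph ω).edgeSet ↔
      ∃ s : Finset.Icc 2 n × Fin m, ((s.1 : ℕ), s.2) = slot e ∧ (ω s : ℕ) = e.2.1 := by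
  constructor
  · rintro ⟨-, s, rfl⟩
    exact ⟨s, rfl, rfl⟩
  · obtain ⟨j, i, a⟩ := e
    rintro ⟨s, hs, hi⟩
    obtain ⟨rfl, rfl⟩ := Prod.mk.inj hs
    obtain rfl : (ω s : ℕ) = i := hi
    have htarget := Finset.mem_Ico.1 (ω s).2
    exact ⟨mem_edgeSet_completeMultigraph.2
      ⟨htarget.1, htarget.2, (Finset.mem_Icc.1 s.1.2).2⟩, s, rfl⟩

theorem dependsOn_mem_presentEvent (n : ℕ) (E : Finset (ℕ × ℕ × Fin m)) :
    DependsOn (fun ω => ω ∈ presentEvent n E)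
      {s : Finset.Icc 2 n × Fin m | ((s.1 : ℕ), s.2) ∈ E.image slot} := by
  refine fun ω ω' hω => propext (forall₂_congr fun e he => ?_)
  rw [mem_edgeSet_attachmentGraph, mem_edgeSet_attachmentGraph]
  refine exists_congr fun s => and_congr_right fun hs => ?_
  have hmem : ((s.1 : ℕ), s.2) ∈ E.image slot := hs.symm ▸ Finset.mem_image_of_mem slot he
  rw [hω s hmem]

theorem presentEvent_union :
    presentEvent n (E ∪ F) = presentEvent n E ∩ presentEvent n F := by
  ext ω
  simp only [presentEvent, Finset.coe_union, Set.union_subset_iff, Set.mem_ofPred_eq,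
    Set.mem_inter_iff]

theorem injOn_slot_of_mem_presentEvent {ω : Choices m n} (hω : ω ∈ presentEvent n E) :
    Set.InjOn slot (E : Set (ℕ × ℕ × Fin m)) := by
  intro e he f hf hef
  obtain ⟨s, hs, hse⟩ := mem_edgeSet_attachmentGraph.1 (hω he)
  obtain ⟨t, ht, htf⟩ := mem_edgeSet_attachmentGraph.1 (hω hf)
  obtain ⟨hvertex, hlabel⟩ := Prod.mk.inj (hs.trans (hef.trans ht.symm))
  obtain rfl : s = t := Prod.ext (Subtype.ext hvertex) hlabel
  obtain ⟨hvertex, hlabel⟩ := Prod.mk.inj hef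
  exact Prod.ext hvertex (Prod.ext (hse.symm.trans htf) hlabel)

theorem indepFun_mem_presentEvent {β : Type*} [MeasurableSpace β] {g : Choices m n → β}
    (hg : DependsOn g {s : Finset.Icc 2 n × Fin m | ((s.1 : ℕ), s.2) ∉ E.image slot}) :
    IndepFun (fun ω => ω ∈ presentEvent n E) g (choiceMeasure m n) := by
  let S := Finset.univ.filter fun s : Finset.Icc 2 n × Fin m => ((s.1 : ℕ), s.2) ∈ E.image slot
  refine indepFun_pi_of_dependsOn (S := S) (T := Sᶜ) .of_discrete .of_discrete ?_ ?_
    disjoint_compl_right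
  · simpa [S] using dependsOn_mem_presentEvent n E
  · simpa [S, Set.compl_def] using hg

theorem dependsOn_mem_presentEvent_of_disjoint (hEF : Disjoint (E.image slot) (F.image slot)) :
    DependsOn (fun ω => ω ∈ presentEvent n F)
      {s : Finset.Icc 2 n × Fin m | ((s.1 : ℕ), s.2) ∉ E.image slot} :=
  (dependsOn_mem_presentEvent n F).mono fun _ hs => Finset.disjoint_right.1 hEF hs

theorem indepFun_presentEvent_eventCount {𝓕 : Finset (Finset (ℕ × ℕ × Fin m))}
    (h𝓕 : ∀ F ∈ 𝓕, Disjoint (E.image slot) (F.image slot)) :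
    IndepFun ((presentEvent n E).indicator (1 : Choices m n → ℕ))
      (eventCount (presentEvent n) 𝓕) (choiceMeasure m n) := by
  classical
  have hcount : DependsOn (eventCount (presentEvent n) 𝓕)
      {s : Finset.Icc 2 n × Fin m | ((s.1 : ℕ), s.2) ∉ E.image slot} := fun ω ω' hω =>
    Finset.sum_congr rfl fun F hF => by
      simp only [Set.indicator_apply, Pi.one_apply,
        dependsOn_mem_presentEvent_of_disjoint (h𝓕 F hF) hω]
  have hindicator : (presentEvent n E).indicator (1 : Choices m n → ℕ) =
      (fun p : Prop => if p then 1 else 0) ∘ fun ω => ω ∈ presentEvent n E :=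
    funext fun ω => Set.indicator_apply ..
  rw [hindicator]
  exact (indepFun_mem_presentEvent hcount).comp .of_discrete measurable_id

theorem measureReal_presentEvent_inter (hEF : Disjoint (E.image slot) (F.image slot)) :
    (choiceMeasure m n).real (presentEvent n E ∩ presentEvent n F) =
      (choiceMeasure m n).real (presentEvent n E) *
        (choiceMeasure m n).real (presentEvent n F) := by
  have h := (indepFun_mem_presentEvent
    (dependsOn_mem_presentEvent_of_disjoint (n := n) hEF)).measure_inter_preimage_eq_mul
      {True} {True} .of_discrete .of_discrete
  simpa [measureReal_def, Set.preimage] using congrArg ENNReal.toReal h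

theorem measureReal_presentEvent_singleton (he : e ∈ (completeMultigraph m n).edgeSet) :
    (choiceMeasure m n).real (presentEvent n {e}) = ((e.1 - 1 : ℕ) : ℝ)⁻¹ := by
  obtain ⟨j, i, a⟩ := e
  obtain ⟨h1, hij, hjn⟩ := mem_edgeSet_completeMultigraph.1 he
  let s : Finset.Icc 2 n × Fin m := (⟨j, Finset.mem_Icc.2 ⟨by lia, hjn⟩⟩, a)
  have hpre : presentEvent n {(j, i, a)} =
      Function.eval s ⁻¹' ({⟨i, Finset.mem_Ico.2 ⟨h1, hij⟩⟩} : Set (Finset.Ico 1 j)) := by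
    ext ω
    simp only [presentEvent, Finset.coe_singleton, Set.singleton_subset_iff, Set.mem_ofPred_eq,
      mem_edgeSet_attachmentGraph, Set.mem_preimage, Set.mem_singleton_iff, Subtype.ext_iff]
    constructor
    · rintro ⟨t, ht, hti⟩
      obtain ⟨hvertex, hlabel⟩ := Prod.mk.inj ht
      obtain rfl : t = s := Prod.ext (Subtype.ext hvertex) hlabel
      exact hti
    · exact fun hi => ⟨s, rfl, hi⟩
  rw [hpre, choiceMeasure, (measurePreserving_eval _ s).measureReal_preimage
    MeasurableSet.of_discrete.nullMeasurableSet]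
  simp [measureReal_def, uniformOn_univ, s, -ENNReal.natCast_sub]

theorem measureReal_presentEvent_of_injOn (hE : ↑E ⊆ (completeMultigraph m n).edgeSet)
    (hslot : Set.InjOn slot (E : Set (ℕ × ℕ × Fin m))) :
    (choiceMeasure m n).real (presentEvent n E) = edgeWeight E := by
  classical
  induction E using Finset.induction_on with
  | empty => simp [presentEvent, edgeWeight]
  | insert e E he ih =>
    rw [Finset.coe_insert, Set.insert_subset_iff] at hE
    rw [Finset.coe_insert, Set.injOn_insert (by exact_mod_cast he)] at hslot
    have hdisj : Disjoint (({e} : Finset (ℕ × ℕ × Fin m)).image slot) (E.image slot) := by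
      rw [Finset.image_singleton, Finset.disjoint_singleton_left]
      exact_mod_cast hslot.2
    rw [Finset.insert_eq, presentEvent_union, measureReal_presentEvent_inter hdisj,
      measureReal_presentEvent_singleton hE.1, ih hE.2 hslot.1, ← Finset.insert_eq, edgeWeight,
      edgeWeight, Finset.prod_insert he]

theorem measureReal_presentEvent_le (hE : ↑E ⊆ (completeMultigraph m n).edgeSet) :
    (choiceMeasure m n).real (presentEvent n E) ≤ edgeWeight E := by
  obtain h | ⟨ω, hω⟩ := (presentEvent n E).eq_empty_or_nonempty
  · rw [h, measureReal_empty]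
    exact edgeWeight_nonneg E
  · exact (measureReal_presentEvent_of_injOn hE (injOn_slot_of_mem_presentEvent hω)).le

end Present

/-! ### Cycles of the complete multigraph -/

section Cycles

variable {m n r : ℕ} {E : Finset (ℕ × ℕ × Fin m)} {v : Fin (r + 1) → ℕ}
  {f : Fin (r + 1) → ℕ × ℕ × Fin m}

/-- The set of endpoints of the edges in `E`. -/
def endpoints (E : Finset (ℕ × ℕ × Fin m)) : Finset ℕ :=
  E.image (fun e => e.1) ∪ E.image fun e => e.2.1

open Classical in
/-- The edge sets of the cycles with `r + 1` vertices in the complete multigraph. -/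
noncomputable def cycleSets (m r n : ℕ) : Finset (Finset (ℕ × ℕ × Fin m)) :=
  {E ∈ (Finset.Icc 1 n ×ˢ Finset.Icc 1 n ×ˢ Finset.univ).powerset |
    ∃ (v : Fin (r + 1) → ℕ) (e : Fin (r + 1) → ℕ × ℕ × Fin m),
      IsCyclicWalk (completeMultigraph m n) v e ∧ Finset.univ.image e = E}

theorem mem_cycleSets : E ∈ cycleSets m r n ↔
    ∃ (v : Fin (r + 1) → ℕ) (e : Fin (r + 1) → ℕ × ℕ × Fin m),
      IsCyclicWalk (completeMultigraph m n) v e ∧ Finset.univ.image e = E := by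
  classical
  rw [cycleSets, Finset.mem_filter, and_iff_right_iff_imp]
  rintro ⟨v, e, h, rfl⟩
  refine Finset.mem_powerset.2 (Finset.image_subset_iff.2 fun i _ => ?_)
  have := mem_edgeSet_completeMultigraph.1 (h.isLink i).edge_mem
  simp only [Finset.mem_product, Finset.mem_Icc, Finset.mem_univ, and_true]
  lia

theorem coe_subset_edgeSet_of_mem_cycleSets (hE : E ∈ cycleSets m r n) :
    ↑E ⊆ (completeMultigraph m n).edgeSet := by
  obtain ⟨v, e, h, rfl⟩ := mem_cycleSets.1 hE
  rw [Finset.coe_image, Finset.coe_univ, Set.image_univ]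
  exact Set.range_subset_iff.2 fun i => (h.isLink i).edge_mem

theorem isCyclicWalk_attachmentGraph_iff {ω : Choices m n} :
    IsCyclicWalk (attachmentGraph ω) v f ↔
      IsCyclicWalk (completeMultigraph m n) v f ∧ ∀ i, f i ∈ (attachmentGraph ω).edgeSet :=
  ⟨fun h => ⟨h.mono Graph.restrict_le, fun i => (h.isLink i).edge_mem⟩,
    fun ⟨h, hf⟩ => ⟨h.injective_vertex, h.injective_edge, fun i => ⟨(hf i).2, h.isLink i⟩⟩⟩

theorem cycleCount_succ_eq_eventCount (m r n : ℕ) :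
    cycleCount m (r + 1) n = eventCount (presentEvent n) (cycleSets m r n) := by
  classical
  funext ω
  have hcount : eventCount (presentEvent n) (cycleSets m r n) ω =
      ((cycleSets m r n).filter fun E => ω ∈ presentEvent n E).card := by
    simp only [eventCount, Set.indicator_apply, Pi.one_apply, Finset.card_filter]
  rw [hcount, cycleCount, ncard_cycleSubgraphs, ← Set.ncard_coe_finset,
    ← Set.ncard_image_of_injective _ Finset.coe_injective]
  congr 1 with F
  simp only [isCyclicWalk_attachmentGraph_iff, Finset.coe_filter, mem_cycleSets, Set.mem_image,
    Set.mem_ofPred_eq]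
  constructor
  · rintro ⟨v, e, ⟨h, he⟩, rfl⟩
    refine ⟨Finset.univ.image e, ⟨⟨v, e, h, rfl⟩, ?_⟩, by simp⟩
    simpa [presentEvent, Set.range_subset_iff] using he
  · rintro ⟨_, ⟨⟨v, e, h, rfl⟩, he⟩, rfl⟩
    refine ⟨v, e, ⟨h, ?_⟩, by simp⟩
    simpa [presentEvent, Set.range_subset_iff] using he

theorem cycleMean_succ_eq_sum (m r n : ℕ) : cycleMean m (r + 1) n =
    ∑ E ∈ cycleSets m r n, (choiceMeasure m n).real (presentEvent n E) := by
  rw [cycleMean, cycleCount_succ_eq_eventCount]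
  exact integral_eventCount fun _ => .of_discrete

namespace IsCyclicWalk

theorem edge_eq (h : IsCyclicWalk (completeMultigraph m n) v f) (i : Fin (r + 1)) :
    f i = (max (v i) (v (i + 1)), min (v i) (v (i + 1)), (f i).2.2) := by
  obtain ⟨hvalid, hends⟩ := h.isLink i
  refine Prod.ext ?_ (Prod.ext ?_ rfl) <;> dsimp only <;> lia

theorem vertex_mem_Icc (h : IsCyclicWalk (completeMultigraph m n) v f) (i : Fin (r + 1)) :
    v i ∈ Finset.Icc 1 n :=
  Finset.mem_Icc.2 (h.isLink i).left_mem

theorem endpoints_image (h : IsCyclicWalk (completeMultigraph m n) v f) :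
    endpoints (Finset.univ.image f) = Finset.univ.image v := by
  ext x
  simp only [endpoints, Finset.mem_union, Finset.mem_image, Finset.mem_univ, true_and,
    exists_exists_eq_and, ← exists_or]
  constructor
  · rintro ⟨i, hi⟩
    rcases (h.isLink i).2 with ⟨hv, hw⟩ | ⟨hv, hw⟩ <;> rcases hi with hx | hx
    exacts [⟨i, hv.trans hx⟩, ⟨i + 1, hw.trans hx⟩, ⟨i + 1, hw.trans hx⟩, ⟨i, hv.trans hx⟩]
  · rintro ⟨i, rfl⟩
    exact ⟨i, (h.isLink i).2.imp (fun hi => hi.1.symm) fun hi => hi.1.symm⟩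

theorem vertices_mem_endpoints (h : IsCyclicWalk (completeMultigraph m n) v f)
    {i : Fin (r + 1)} (hi : f i ∈ E) : v i ∈ endpoints E ∧ v (i + 1) ∈ endpoints E := by
  have hfst : (f i).1 ∈ endpoints E :=
    Finset.mem_union_left _ (Finset.mem_image_of_mem (fun e => e.1) hi)
  have hsnd : (f i).2.1 ∈ endpoints E :=
    Finset.mem_union_right _ (Finset.mem_image_of_mem (fun e => e.2.1) hi)
  rcases (h.isLink i).2 with ⟨hv, hw⟩ | ⟨hv, hw⟩ <;> rw [hv, hw]
  exacts [⟨hfst, hsnd⟩, ⟨hsnd, hfst⟩]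

end IsCyclicWalk

theorem card_of_mem_cycleSets (hE : E ∈ cycleSets m r n) : E.card = r + 1 := by
  obtain ⟨v, e, h, rfl⟩ := mem_cycleSets.1 hE
  rw [Finset.card_image_of_injective _ h.injective_edge, Finset.card_fin]

theorem card_endpoints_le_of_mem_cycleSets (hE : E ∈ cycleSets m r n) :
    (endpoints E).card ≤ r + 1 := by
  obtain ⟨v, e, h, rfl⟩ := mem_cycleSets.1 hE
  rw [h.endpoints_image]
  exact Finset.card_image_le.trans_eq (Finset.card_fin _)

theorem endpoints_subset_Icc_of_mem_cycleSets (hE : E ∈ cycleSets m r n) :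
    endpoints E ⊆ Finset.Icc 1 n := by
  obtain ⟨v, e, h, rfl⟩ := mem_cycleSets.1 hE
  rw [h.endpoints_image, Finset.image_subset_iff]
  exact fun i _ => h.vertex_mem_Icc i

end Cycles

/-! ### Weighted sums over cycles -/

section WeightedSums

variable {m n r : ℕ} {A : Finset ℕ} {E : Finset (ℕ × ℕ × Fin m)} {v : Fin (r + 1) → ℕ}
  {e : Fin (r + 1) → ℕ × ℕ × Fin m}

theorem inv_natCast_sub_one_le (x : ℕ) : ((x - 1 : ℕ) : ℝ)⁻¹ ≤ 2 * (x : ℝ)⁻¹ := by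
  obtain hx | hx : x ≤ 1 ∨ 2 ≤ x := by lia
  · rw [Nat.sub_eq_zero_of_le hx, Nat.cast_zero, inv_zero]
    positivity
  · have hx' : (2 : ℝ) ≤ x := by exact_mod_cast hx
    rw [Nat.cast_sub (by lia), Nat.cast_one, ← div_eq_mul_inv, inv_eq_one_div,
      div_le_div_iff₀ (by linarith) (by linarith)]
    linarith

theorem edgeWeight_image_sdiff {ι : Type*} [Fintype ι]
    {e : ι → ℕ × ℕ × Fin m} (he : Function.Injective e) (E : Finset (ℕ × ℕ × Fin m)) :
    edgeWeight (Finset.univ.image e \ E) =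
      ∏ i, if e i ∈ E then 1 else (((e i).1 - 1 : ℕ) : ℝ)⁻¹ := by
  rw [edgeWeight, Finset.sdiff_eq_filter, Finset.prod_filter, Finset.prod_image he.injOn]
  exact Finset.prod_congr rfl fun i _ => ite_not ..

namespace IsCyclicWalk

theorem inv_edge_le (h : IsCyclicWalk (completeMultigraph m n) v e) (i : Fin (r + 1)) :
    (((e i).1 - 1 : ℕ) : ℝ)⁻¹ ≤ 2 * (max (v i : ℝ) (v (i + 1)))⁻¹ := by
  have hmax : (e i).1 = max (v i) (v (i + 1)) := congrArg Prod.fst (h.edge_eq i)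
  rw [hmax, ← Nat.cast_max]
  exact inv_natCast_sub_one_le _

theorem ite_edge_le_walkKernel
    (h : IsCyclicWalk (completeMultigraph m n) v e) (hEA : endpoints E ⊆ A) (i : Fin (r + 1)) :
    (if e i ∈ E then 1 else (((e i).1 - 1 : ℕ) : ℝ)⁻¹) ≤ walkKernel A (v i) (v (i + 1)) := by
  have hkernel : walkKernel A (v i) (v (i + 1)) = 2 * (max (v i : ℝ) (v (i + 1)))⁻¹ +
    if v i ∈ A ∧ v (i + 1) ∈ A then 1 else 0 := rfl
  rw [hkernel]
  split_ifs with hi hA hA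
  · exact le_add_of_nonneg_left (by positivity)
  · exact absurd ((h.vertices_mem_endpoints hi).imp (@hEA _) (@hEA _)) hA
  · exact (h.inv_edge_le i).trans (le_add_of_nonneg_right zero_le_one)
  · exact (h.inv_edge_le i).trans_eq (add_zero _).symm

/-- Only the last edge is known to lie outside `E`; every other edge in `E` is charged to the
indicator term of the kernel. -/
theorem edgeWeight_sdiff_le
    (h : IsCyclicWalk (completeMultigraph m n) v e) (hEA : endpoints E ⊆ A)
    (hlast : e (Fin.last r) ∉ E) :
    edgeWeight (Finset.univ.image e \ E) ≤
      (∏ i : Fin r, walkKernel A (v i.castSucc) (v i.succ)) *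
        (2 * (max (v (Fin.last r) : ℝ) (v 0))⁻¹) := by
  rw [edgeWeight_image_sdiff h.injective_edge, Fin.prod_univ_castSucc, if_neg hlast]
  have hclose := h.inv_edge_le (Fin.last r)
  rw [Fin.last_add_one] at hclose
  gcongr with i
  · exact Finset.prod_nonneg fun i _ => walkKernel_nonneg ..
  · simpa only [Fin.coeSucc_eq_succ] using h.ite_edge_le_walkKernel hEA i.castSucc

end IsCyclicWalk

/-- The constant in the bounds for the weighted sums over cycles. -/
noncomputable def cycleConst (m r : ℕ) : ℝ :=
  m ^ (r + 1) * (2 * (9 + 2 * (r + 1 : ℝ) ^ 2 + (r + 1)) ^ r * (1 + (r + 1)))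

theorem cycleConst_nonneg (m r : ℕ) : 0 ≤ cycleConst m r := by
  unfold cycleConst
  positivity

theorem sum_cyclicWalk_le {ι : Type*} [Fintype ι] {φ : (Fin (r + 1) → ℕ) → ℝ}
    (hφ : ∀ w, 0 ≤ φ w) {v : ι → Fin (r + 1) → ℕ} {e : ι → Fin (r + 1) → ℕ × ℕ × Fin m}
    (hwalk : ∀ i, IsCyclicWalk (completeMultigraph m n) (v i) (e i))
    (he : Function.Injective e) :
    ∑ i, φ (v i) ≤ m ^ (r + 1) * ∑ w ∈ Fintype.piFinset fun _ => Finset.Icc 1 n, φ w := by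
  let code (i : ι) := (v i, fun k => (e i k).2.2)
  have hcode_injective : Function.Injective code := by
    intro i j hij
    obtain ⟨hv, hlabel⟩ := Prod.mk.inj hij
    refine he (funext fun k => ?_)
    rw [(hwalk i).edge_eq, (hwalk j).edge_eq, hv, congrFun hlabel k]
  have hcode_mem : Finset.univ.image code ⊆
      (Fintype.piFinset fun _ => Finset.Icc 1 n) ×ˢ Finset.univ := by
    refine Finset.image_subset_iff.2 fun i _ => Finset.mem_product.2 ⟨?_, Finset.mem_univ _⟩
    exact Fintype.mem_piFinset.2 (hwalk i).vertex_mem_Icc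
  calc ∑ i, φ (v i) = ∑ p ∈ Finset.univ.image code, φ p.1 :=
        (Finset.sum_image (f := fun p => φ p.1) hcode_injective.injOn).symm
    _ ≤ ∑ p ∈ (Fintype.piFinset fun _ => Finset.Icc 1 n) ×ˢ Finset.univ, φ p.1 :=
        Finset.sum_le_sum_of_subset_of_nonneg hcode_mem fun p _ _ => hφ p.1
    _ = m ^ (r + 1) * ∑ w ∈ Fintype.piFinset fun _ => Finset.Icc 1 n, φ w := by
        simp [Finset.sum_product, Finset.mul_sum]

theorem sum_edgeWeight_sdiff_le
    {𝓕 : Finset (Finset (ℕ × ℕ × Fin m))} (hA : A ⊆ Finset.Icc 1 n) (hAcard : A.card ≤ r + 1)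
    (hEA : endpoints E ⊆ A)
    (h𝓕 : ∀ F ∈ 𝓕, ∃ (v : Fin (r + 1) → ℕ) (e : Fin (r + 1) → ℕ × ℕ × Fin m),
      IsCyclicWalk (completeMultigraph m n) v e ∧ Finset.univ.image e = F ∧ v 0 ∈ A ∧
        e (Fin.last r) ∉ E) :
    ∑ F ∈ 𝓕, edgeWeight (F \ E) ≤ cycleConst m r * ∑ x ∈ A, (x : ℝ)⁻¹ := by
  choose v e hwalk himage hstart hlast using fun F : 𝓕 => h𝓕 F F.2
  have he : Function.Injective e := fun F G hFG =>
    Subtype.ext ((himage F).symm.trans (hFG ▸ himage G))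
  let walkTerm (w : Fin (r + 1) → ℕ) : ℝ := if w 0 ∈ A then
    (∏ i : Fin r, walkKernel A (w i.castSucc) (w i.succ)) *
      (2 * (max (w (Fin.last r) : ℝ) (w 0))⁻¹) else 0
  have hterm_nonneg (w : Fin (r + 1) → ℕ) : 0 ≤ walkTerm w := by
    have := Finset.prod_nonneg fun (i : Fin r) (_ : i ∈ Finset.univ) =>
      walkKernel_nonneg A (w i.castSucc) (w i.succ)
    dsimp only [walkTerm]
    positivity
  have hweight (F : 𝓕) : edgeWeight (F.1 \ E) ≤ walkTerm (v F) := by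
    have hF := (hwalk F).edgeWeight_sdiff_le hEA (hlast F)
    rw [himage F] at hF
    exact hF.trans_eq (if_pos (hstart F)).symm
  calc ∑ F ∈ 𝓕, edgeWeight (F \ E) = ∑ F : 𝓕, edgeWeight (F.1 \ E) :=
        (Finset.sum_coe_sort 𝓕 fun F => edgeWeight (F \ E)).symm
    _ ≤ ∑ F : 𝓕, walkTerm (v F) := Finset.sum_le_sum fun F _ => hweight F
    _ ≤ m ^ (r + 1) * ∑ w ∈ Fintype.piFinset fun _ => Finset.Icc 1 n, walkTerm w :=
        sum_cyclicWalk_le hterm_nonneg hwalk he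
    _ ≤ m ^ (r + 1) * (2 * (9 + 2 * (A.card : ℝ) ^ 2 + A.card) ^ r * (1 + A.card) *
          ∑ x ∈ A, (x : ℝ)⁻¹) := by
        gcongr
        exact sum_closed_walk_le hA r
    _ ≤ cycleConst m r * ∑ x ∈ A, (x : ℝ)⁻¹ := by
        have hcard : (A.card : ℝ) ≤ r + 1 := by exact_mod_cast hAcard
        rw [cycleConst, ← mul_assoc]
        gcongr

theorem sum_edgeWeight_meeting_le (hA : A ⊆ Finset.Icc 1 n) (hAcard : A.card ≤ r + 1) :
    ∑ F ∈ cycleSets m r n with ¬Disjoint A (endpoints F), edgeWeight F ≤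
      cycleConst m r * ∑ x ∈ A, (x : ℝ)⁻¹ := by
  simpa only [Finset.sdiff_empty] using sum_edgeWeight_sdiff_le (m := m) (E := ∅) hA hAcard
    (by simp [endpoints]) fun F hF => by
      obtain ⟨hF, hmeet⟩ := Finset.mem_filter.1 hF
      obtain ⟨v, e, h, rfl⟩ := mem_cycleSets.1 hF
      obtain ⟨x, hxA, hx⟩ := Finset.not_disjoint_iff.1 hmeet
      rw [h.endpoints_image] at hx
      obtain ⟨k, -, rfl⟩ := Finset.mem_image.1 hx
      exact ⟨_, _, h.rotate k, image_univ_add_right e k, by simpa using hxA, Finset.notMem_empty _⟩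

theorem sum_edgeWeight_overlap_le (hE : E ∈ cycleSets m r n) :
    ∑ F ∈ (cycleSets m r n).erase E with ¬Disjoint E F, edgeWeight (F \ E) ≤
      cycleConst m r * ∑ x ∈ endpoints E, (x : ℝ)⁻¹ := by
  refine sum_edgeWeight_sdiff_le (endpoints_subset_Icc_of_mem_cycleSets hE)
    (card_endpoints_le_of_mem_cycleSets hE) subset_rfl fun F hF => ?_
  obtain ⟨hF, hmeet⟩ := Finset.mem_filter.1 hF
  obtain ⟨hne, hF⟩ := Finset.mem_erase.1 hF
  obtain ⟨f, hfE, hfF⟩ := Finset.not_disjoint_iff.1 hmeet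
  have hnot : ¬F ⊆ E := fun hFE => hne (Finset.eq_of_subset_of_card_le hFE
    ((card_of_mem_cycleSets hE).trans (card_of_mem_cycleSets hF).symm).le)
  obtain ⟨v, e, h, rfl⟩ := mem_cycleSets.1 hF
  obtain ⟨i, -, rfl⟩ := Finset.mem_image.1 hfF
  obtain ⟨k, hk⟩ : ∃ k, e k ∉ E := by simpa [Finset.image_subset_iff] using hnot
  obtain ⟨j, hj, hj'⟩ := exists_and_not_sub_one (p := fun i => e i ∈ E) hfE hk
  refine ⟨_, _, h.rotate j, image_univ_add_right e j, ?_, ?_⟩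
  · simpa using (h.vertices_mem_endpoints hj).1
  · have hlast : Fin.last r + j = j - 1 := by
      rw [eq_sub_iff_add_eq, add_right_comm, Fin.last_add_one, zero_add]
    rwa [hlast]

theorem sum_inv_sq_le_two (n : ℕ) : ∑ x ∈ Finset.Icc 1 n, ((x : ℝ) ^ 2)⁻¹ ≤ 2 := by
  have hIcc : Finset.Icc 1 n = Finset.Ioo 0 (n + 1) := by
    ext x
    simp only [Finset.mem_Icc, Finset.mem_Ioo]
    lia
  simpa [hIcc] using sum_Ioo_inv_sq_le (α := ℝ) 0 (n + 1)

theorem sum_edgeWeight_mul_sum_endpoints_le (m r n : ℕ) {φ : ℕ → ℝ} (hφ : ∀ x, 0 ≤ φ x) :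
    ∑ E ∈ cycleSets m r n, edgeWeight E * ∑ x ∈ endpoints E, φ x ≤
      cycleConst m r * ∑ x ∈ Finset.Icc 1 n, φ x * (x : ℝ)⁻¹ := by
  calc ∑ E ∈ cycleSets m r n, edgeWeight E * ∑ x ∈ endpoints E, φ x
      = ∑ E ∈ cycleSets m r n, ∑ x ∈ Finset.Icc 1 n with x ∈ endpoints E, φ x * edgeWeight E := by
        refine Finset.sum_congr rfl fun E hE => ?_
        rw [Finset.filter_mem_eq_inter,
          Finset.inter_eq_right.2 (endpoints_subset_Icc_of_mem_cycleSets hE), ← Finset.sum_mul,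
          mul_comm]
    _ = ∑ x ∈ Finset.Icc 1 n, φ x * ∑ E ∈ cycleSets m r n with ¬Disjoint {x} (endpoints E),
          edgeWeight E := by
        simp only [Finset.sum_filter, Finset.mul_sum, Finset.disjoint_singleton_left, not_not,
          mul_ite, mul_zero]
        exact Finset.sum_comm
    _ ≤ ∑ x ∈ Finset.Icc 1 n, φ x * (cycleConst m r * (x : ℝ)⁻¹) := by
        gcongr with x hx
        · exact hφ x
        · simpa using sum_edgeWeight_meeting_le (m := m) (r := r)
            (Finset.singleton_subset_iff.2 hx) (by simp)
    _ = cycleConst m r * ∑ x ∈ Finset.Icc 1 n, φ x * (x : ℝ)⁻¹ := by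
        rw [Finset.mul_sum]
        exact Finset.sum_congr rfl fun x _ => by ring

theorem one_le_sum_endpoints_of_mem_cycleSets (hE : E ∈ cycleSets m r n) :
    1 ≤ ∑ _x ∈ endpoints E, (1 : ℝ) := by
  obtain ⟨v, e, h, rfl⟩ := mem_cycleSets.1 hE
  rw [h.endpoints_image, Finset.sum_const, nsmul_one, Nat.one_le_cast]
  exact (Finset.univ_nonempty.image v).card_pos

theorem cycleMean_succ_le (m r n : ℕ) :
    cycleMean m (r + 1) n ≤ cycleConst m r * (1 + Real.log n) := by
  calc cycleMean m (r + 1) n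
      = ∑ E ∈ cycleSets m r n, (choiceMeasure m n).real (presentEvent n E) :=
        cycleMean_succ_eq_sum m r n
    _ ≤ ∑ E ∈ cycleSets m r n, edgeWeight E * ∑ _x ∈ endpoints E, (1 : ℝ) :=
        Finset.sum_le_sum fun E hE =>
          (measureReal_presentEvent_le (coe_subset_edgeSet_of_mem_cycleSets hE)).trans
            (le_mul_of_one_le_right (edgeWeight_nonneg E)
              (one_le_sum_endpoints_of_mem_cycleSets hE))
    _ ≤ cycleConst m r * ∑ x ∈ Finset.Icc 1 n, 1 * (x : ℝ)⁻¹ :=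
        sum_edgeWeight_mul_sum_endpoints_le m r n fun _ => zero_le_one
    _ ≤ cycleConst m r * (1 + Real.log n) := by
        gcongr
        · exact cycleConst_nonneg m r
        · simpa [harmonic_eq_sum_Icc] using harmonic_le_one_add_log n

end WeightedSums

/-! ### Monotone cycles -/

theorem sum_powersetCard_Icc_sup {M : Type*} [AddCommMonoid M] (r n : ℕ) (φ : ℕ → M) :
    ∑ t ∈ (Finset.Icc 1 n).powersetCard (r + 1), φ (t.sup id) =
      ∑ k ∈ Finset.range n, k.choose r • φ (k + 1) := by
  induction n with
  | zero =>
    rw [Finset.powersetCard_eq_empty.2 (by simp)]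
    simp
  | succ n ih =>
    have hnot : n + 1 ∉ Finset.Icc 1 n := by simp
    have hnotMem (t) (ht : t ∈ (Finset.Icc 1 n).powersetCard r) : n + 1 ∉ t :=
      fun h => hnot ((Finset.mem_powersetCard.1 ht).1 h)
    have hsup (t) (ht : t ∈ (Finset.Icc 1 n).powersetCard r) :
        (insert (n + 1) t).sup id = n + 1 := by
      rw [Finset.sup_insert]
      refine sup_eq_left.2 (Finset.sup_le fun x hx => ?_)
      have := Finset.mem_Icc.1 ((Finset.mem_powersetCard.1 ht).1 hx)
      simp only [id_eq]
      lia
    have hdisj : Disjoint ((Finset.Icc 1 n).powersetCard (r + 1))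
        (((Finset.Icc 1 n).powersetCard r).image (insert (n + 1))) := by
      refine Finset.disjoint_left.2 fun t ht ht' => hnot ?_
      obtain ⟨s, -, rfl⟩ := Finset.mem_image.1 ht'
      exact (Finset.mem_powersetCard.1 ht).1 (Finset.mem_insert_self _ _)
    rw [← Finset.insert_Icc_right_eq_Icc_add_one (by lia), Finset.powersetCard_succ_insert hnot,
      Finset.sum_union hdisj, ih, Finset.sum_range_succ, Finset.sum_image,
      Finset.sum_congr rfl fun t ht => congrArg φ (hsup t ht), Finset.sum_const,
      Finset.card_powersetCard, Nat.card_Icc, Nat.add_sub_cancel]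
    intro s hs t ht hst
    rw [← Finset.erase_insert (hnotMem s hs), ← Finset.erase_insert (hnotMem t ht), hst]

theorem inv_two_pow_mul_factorial_mul_inv_le {r k : ℕ} (hk : 2 * r ≤ k) :
    ((2 : ℝ) ^ r * r.factorial)⁻¹ * (k : ℝ)⁻¹ ≤ k.choose r * (k : ℝ)⁻¹ ^ (r + 1) := by
  obtain rfl | hk0 := k.eq_zero_or_pos
  · simp
  have hk' : (2 : ℝ) * r ≤ k := by exact_mod_cast hk
  have hbase : (k : ℝ) / 2 ≤ (k + 1 - r : ℕ) := by
    rw [Nat.cast_sub (by lia), Nat.cast_add, Nat.cast_one]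
    linarith
  have hchoose : ((k : ℝ) / 2) ^ r / r.factorial ≤ k.choose r :=
    (by gcongr : _ ≤ (((k + 1 - r : ℕ) : ℝ) ^ r) / r.factorial).trans (Nat.pow_le_choose r k)
  calc ((2 : ℝ) ^ r * r.factorial)⁻¹ * (k : ℝ)⁻¹
      = ((k : ℝ) / 2) ^ r / r.factorial * (k : ℝ)⁻¹ ^ (r + 1) := by
        rw [div_pow, inv_pow, pow_succ]
        field_simp
    _ ≤ k.choose r * (k : ℝ)⁻¹ ^ (r + 1) := by gcongr

theorem log_sub_le_sum_choose (r n : ℕ) :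
    ((2 : ℝ) ^ r * r.factorial)⁻¹ * (Real.log n - 2 * r) ≤
      ∑ k ∈ Finset.range n, k.choose r * (k : ℝ)⁻¹ ^ (r + 1) := by
  have hlog : Real.log n ≤ ∑ k ∈ Finset.range n, (k : ℝ)⁻¹ := by
    obtain _ | n := n
    · simp
    · rw [Finset.sum_range_succ']
      simpa [harmonic] using log_add_one_le_harmonic n
  have hsmall : ∑ k ∈ Finset.range n, (if k < 2 * r then (1 : ℝ) else 0) ≤ 2 * r := by
    rw [Finset.sum_boole]
    exact_mod_cast (Finset.card_le_card fun k hk =>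
      Finset.mem_range.2 (Finset.mem_filter.1 hk).2).trans_eq (Finset.card_range (2 * r))
  calc ((2 : ℝ) ^ r * r.factorial)⁻¹ * (Real.log n - 2 * r)
      ≤ ((2 : ℝ) ^ r * r.factorial)⁻¹ * (∑ k ∈ Finset.range n, (k : ℝ)⁻¹ -
          ∑ k ∈ Finset.range n, if k < 2 * r then (1 : ℝ) else 0) := by gcongr
    _ = ∑ k ∈ Finset.range n,
          ((2 : ℝ) ^ r * r.factorial)⁻¹ * ((k : ℝ)⁻¹ - if k < 2 * r then (1 : ℝ) else 0) := by
        rw [← Finset.sum_sub_distrib, Finset.mul_sum]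
    _ ≤ ∑ k ∈ Finset.range n, k.choose r * (k : ℝ)⁻¹ ^ (r + 1) := by
        refine Finset.sum_le_sum fun k _ => ?_
        split_ifs with hk
        · have hinv : (k : ℝ)⁻¹ ≤ 1 := Nat.cast_inv_le_one k
          exact (mul_nonpos_of_nonneg_of_nonpos (by positivity) (by linarith)).trans (by positivity)
        · rw [sub_zero]
          exact inv_two_pow_mul_factorial_mul_inv_le (by lia)

section MonotoneCycles

variable {m n r : ℕ} {E : Finset (ℕ × ℕ × Fin m)} {t : Finset ℕ}

/-- The cycle visits `t` in increasing order; the edge that returns to the minimum of `t` has the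
same slot vertex as the one before it, so it gets another label. -/
theorem exists_mem_cycleSets_endpoints_eq (hm : 2 ≤ m) (hr : 1 ≤ r)
    (ht : t ∈ (Finset.Icc 1 n).powersetCard (r + 1)) :
    ∃ E ∈ cycleSets m r n, endpoints E = t ∧ Set.InjOn slot (E : Set (ℕ × ℕ × Fin m)) := by
  obtain ⟨htn, hcard⟩ := Finset.mem_powersetCard.1 ht
  have : Nontrivial (Fin (r + 1)) := Fin.nontrivial_iff_two_le.2 (by lia)
  have : Nontrivial (Fin m) := Fin.nontrivial_iff_two_le.2 hm
  obtain ⟨a, b, hab⟩ := exists_pair_ne (Fin m)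
  let v := t.orderEmbOfFin hcard
  let e (i : Fin (r + 1)) : ℕ × ℕ × Fin m :=
    (max (v i) (v (i + 1)), min (v i) (v (i + 1)), if i = Fin.last r then a else b)
  have hfst {i : Fin (r + 1)} (hi : i ≠ Fin.last r) : (e i).1 = v (i + 1) :=
    max_eq_right (v.monotone (Fin.lt_add_one_iff.2 (Fin.lt_last_iff_ne_last.2 hi)).le)
  have hslot : Function.Injective (slot ∘ e) := by
    intro i k hik
    obtain ⟨hvertex, hlabel⟩ := Prod.mk.inj hik
    by_cases hi : i = Fin.last r <;> by_cases hk : k = Fin.last r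
    · rw [hi, hk]
    · simp [e, hi, hk, hab] at hlabel
    · simp [e, hi, hk, hab.symm] at hlabel
    · rw [hfst hi, hfst hk] at hvertex
      exact add_right_cancel (v.injective hvertex)
  have hwalk : IsCyclicWalk (completeMultigraph m n) v e := by
    refine ⟨v.injective, hslot.of_comp, fun i => ⟨?_, ?_⟩⟩
    · have hne : v i ≠ v (i + 1) := v.injective.ne (by simp; lia)
      have hi := Finset.mem_Icc.1 (htn (t.orderEmbOfFin_mem hcard i))
      have hi' := Finset.mem_Icc.1 (htn (t.orderEmbOfFin_mem hcard (i + 1)))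
      dsimp only [e, v] at hne ⊢
      lia
    · dsimp only [e]
      lia
  refine ⟨_, mem_cycleSets.2 ⟨v, e, hwalk, rfl⟩, ?_, ?_⟩
  · rw [hwalk.endpoints_image, ← Finset.coe_inj, Finset.coe_image, Finset.coe_univ, Set.image_univ]
    exact t.range_orderEmbOfFin hcard
  · rw [Finset.coe_image, Finset.coe_univ, Set.image_univ]
    exact hslot.injOn_range

theorem inv_pow_le_edgeWeight (hE : E ∈ cycleSets m r n) :
    (((endpoints E).sup id - 1 : ℕ) : ℝ)⁻¹ ^ (r + 1) ≤ edgeWeight E := by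
  rw [← card_of_mem_cycleSets hE, ← Finset.prod_const, edgeWeight]
  refine Finset.prod_le_prod (fun _ _ => by positivity) fun e he => ?_
  have hedge := mem_edgeSet_completeMultigraph.1 (coe_subset_edgeSet_of_mem_cycleSets hE he)
  have hsup : e.1 ≤ (endpoints E).sup id :=
    Finset.le_sup (f := id) (Finset.mem_union_left _ (Finset.mem_image_of_mem (fun e => e.1) he))
  have hpos : 0 < e.1 - 1 := by lia
  gcongr

theorem log_sub_le_cycleMean_succ (hm : 2 ≤ m) (hr : 1 ≤ r) (n : ℕ) :
    ((2 : ℝ) ^ r * r.factorial)⁻¹ * (Real.log n - 2 * r) ≤ cycleMean m (r + 1) n := by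
  choose! E hE hendpoints hslot using fun t (ht : t ∈ (Finset.Icc 1 n).powersetCard (r + 1)) =>
    exists_mem_cycleSets_endpoints_eq hm hr ht
  have hinj : Set.InjOn E ((Finset.Icc 1 n).powersetCard (r + 1)) := fun s hs t ht hst => by
    rw [← hendpoints s hs, hst, hendpoints t ht]
  calc ((2 : ℝ) ^ r * r.factorial)⁻¹ * (Real.log n - 2 * r)
      ≤ ∑ k ∈ Finset.range n, k.choose r * (k : ℝ)⁻¹ ^ (r + 1) := log_sub_le_sum_choose r n
    _ = ∑ t ∈ (Finset.Icc 1 n).powersetCard (r + 1), ((t.sup id - 1 : ℕ) : ℝ)⁻¹ ^ (r + 1) := by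
        rw [sum_powersetCard_Icc_sup r n fun j => ((j - 1 : ℕ) : ℝ)⁻¹ ^ (r + 1)]
        simp only [nsmul_eq_mul, Nat.add_sub_cancel]
    _ ≤ ∑ t ∈ (Finset.Icc 1 n).powersetCard (r + 1),
          (choiceMeasure m n).real (presentEvent n (E t)) := by
        refine Finset.sum_le_sum fun t ht => ?_
        rw [measureReal_presentEvent_of_injOn (coe_subset_edgeSet_of_mem_cycleSets (hE t ht))
          (hslot t ht)]
        nth_rewrite 1 [← hendpoints t ht]
        exact inv_pow_le_edgeWeight (hE t ht)
    _ = ∑ F ∈ ((Finset.Icc 1 n).powersetCard (r + 1)).image E,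
          (choiceMeasure m n).real (presentEvent n F) :=
        (Finset.sum_image (f := fun F => (choiceMeasure m n).real (presentEvent n F)) hinj).symm
    _ ≤ ∑ F ∈ cycleSets m r n, (choiceMeasure m n).real (presentEvent n F) :=
        Finset.sum_le_sum_of_subset_of_nonneg (Finset.image_subset_iff.2 hE)
          fun _ _ _ => measureReal_nonneg
    _ = cycleMean m (r + 1) n := (cycleMean_succ_eq_sum m r n).symm

end MonotoneCycles

/-! ### Poisson approximation of the number of cycles -/

section PoissonApproximation

variable {m n r : ℕ} {E F : Finset (ℕ × ℕ × Fin m)}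

/-- The neighbourhood of the cycle `E` in the dependency graph: the cycles that depend on one of
the choices on which `E` depends. -/
noncomputable def slotNeighbours (m r n : ℕ) (E : Finset (ℕ × ℕ × Fin m)) :
    Finset (Finset (ℕ × ℕ × Fin m)) :=
  {F ∈ cycleSets m r n | ¬Disjoint (E.image slot) (F.image slot)}

theorem not_disjoint_endpoints (h : ¬Disjoint (E.image slot) (F.image slot)) :
    ¬Disjoint (endpoints E) (endpoints F) := by
  have hfst (G : Finset (ℕ × ℕ × Fin m)) : (G.image slot).image Prod.fst ⊆ endpoints G := by
    rw [Finset.image_image]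
    exact Finset.subset_union_left
  obtain ⟨s, hsE, hsF⟩ := Finset.not_disjoint_iff.1 h
  exact Finset.not_disjoint_iff.2 ⟨s.1, hfst E (Finset.mem_image_of_mem _ hsE),
    hfst F (Finset.mem_image_of_mem _ hsF)⟩

theorem presentEvent_inter_eq_empty (hEF : Disjoint E F)
    (h : ¬Disjoint (E.image slot) (F.image slot)) :
    presentEvent n E ∩ presentEvent n F = ∅ := by
  rw [← presentEvent_union]
  refine Set.eq_empty_of_forall_notMem fun ω hω => h ?_
  have hinj := injOn_slot_of_mem_presentEvent hω
  rw [Finset.coe_union] at hinj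
  rw [← Finset.disjoint_coe, Finset.coe_image, Finset.coe_image, Set.disjoint_iff_inter_eq_empty,
    ← hinj.image_inter Set.subset_union_left Set.subset_union_right, ← Finset.coe_inter,
    Finset.disjoint_iff_inter_eq_empty.1 hEF, Finset.coe_empty, Set.image_empty]

theorem measureReal_presentEvent_inter_le (hE : ↑E ⊆ (completeMultigraph m n).edgeSet)
    (hF : ↑F ⊆ (completeMultigraph m n).edgeSet) :
    (choiceMeasure m n).real (presentEvent n E ∩ presentEvent n F) ≤
      edgeWeight E * edgeWeight (F \ E) := by
  rw [← presentEvent_union, edgeWeight, edgeWeight, ← Finset.prod_union Finset.disjoint_sdiff,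
    Finset.union_sdiff_self_eq_union]
  refine measureReal_presentEvent_le ?_
  rw [Finset.coe_union]
  exact Set.union_subset hE hF

theorem sum_mul_measureReal_slotNeighbours_le (hE : E ∈ cycleSets m r n) :
    ∑ F ∈ slotNeighbours m r n E,
        (choiceMeasure m n).real (presentEvent n E) * (choiceMeasure m n).real (presentEvent n F) ≤
      edgeWeight E * (cycleConst m r * ∑ x ∈ endpoints E, (x : ℝ)⁻¹) := by
  have hneighbours : ∑ F ∈ slotNeighbours m r n E, (choiceMeasure m n).real (presentEvent n F) ≤
      cycleConst m r * ∑ x ∈ endpoints E, (x : ℝ)⁻¹ :=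
    calc ∑ F ∈ slotNeighbours m r n E, (choiceMeasure m n).real (presentEvent n F)
        ≤ ∑ F ∈ slotNeighbours m r n E, edgeWeight F := Finset.sum_le_sum fun F hF =>
          measureReal_presentEvent_le
            (coe_subset_edgeSet_of_mem_cycleSets (Finset.mem_filter.1 hF).1)
      _ ≤ ∑ F ∈ cycleSets m r n with ¬Disjoint (endpoints E) (endpoints F), edgeWeight F :=
          Finset.sum_le_sum_of_subset_of_nonneg
            (Finset.monotone_filter_right _ fun F _ => not_disjoint_endpoints)
            fun F _ _ => edgeWeight_nonneg F
      _ ≤ cycleConst m r * ∑ x ∈ endpoints E, (x : ℝ)⁻¹ :=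
          sum_edgeWeight_meeting_le (endpoints_subset_Icc_of_mem_cycleSets hE)
            (card_endpoints_le_of_mem_cycleSets hE)
  rw [← Finset.mul_sum]
  exact mul_le_mul (measureReal_presentEvent_le (coe_subset_edgeSet_of_mem_cycleSets hE))
    hneighbours (Finset.sum_nonneg fun _ _ => measureReal_nonneg) (edgeWeight_nonneg E)

theorem sum_measureReal_inter_slotNeighbours_le (hE : E ∈ cycleSets m r n) :
    ∑ F ∈ (slotNeighbours m r n E).erase E,
        (choiceMeasure m n).real (presentEvent n E ∩ presentEvent n F) ≤
      edgeWeight E * (cycleConst m r * ∑ x ∈ endpoints E, (x : ℝ)⁻¹) := by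
  have hterm (F) (hF : F ∈ (slotNeighbours m r n E).erase E) :
      (choiceMeasure m n).real (presentEvent n E ∩ presentEvent n F) ≤
        if Disjoint E F then 0 else edgeWeight E * edgeWeight (F \ E) := by
    obtain ⟨hF, hshare⟩ := Finset.mem_filter.1 (Finset.mem_of_mem_erase hF)
    split_ifs with hEF
    · rw [presentEvent_inter_eq_empty hEF hshare, measureReal_empty]
    · exact measureReal_presentEvent_inter_le (coe_subset_edgeSet_of_mem_cycleSets hE)
        (coe_subset_edgeSet_of_mem_cycleSets hF)
  have hnonneg (F : Finset (ℕ × ℕ × Fin m)) :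
      0 ≤ if Disjoint E F then 0 else edgeWeight E * edgeWeight (F \ E) := by
    have := edgeWeight_nonneg E
    have := edgeWeight_nonneg (F \ E)
    positivity
  calc ∑ F ∈ (slotNeighbours m r n E).erase E,
        (choiceMeasure m n).real (presentEvent n E ∩ presentEvent n F)
      ≤ ∑ F ∈ (slotNeighbours m r n E).erase E,
          if Disjoint E F then 0 else edgeWeight E * edgeWeight (F \ E) := Finset.sum_le_sum hterm
    _ ≤ ∑ F ∈ (cycleSets m r n).erase E,
          if Disjoint E F then 0 else edgeWeight E * edgeWeight (F \ E) :=
        Finset.sum_le_sum_of_subset_of_nonneg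
          (Finset.erase_subset_erase _ (Finset.filter_subset _ _)) fun F _ _ => hnonneg F
    _ = edgeWeight E * ∑ F ∈ (cycleSets m r n).erase E with ¬Disjoint E F, edgeWeight (F \ E) := by
        rw [Finset.mul_sum, Finset.sum_filter]
        exact Finset.sum_congr rfl fun F _ => (ite_not ..).symm
    _ ≤ edgeWeight E * (cycleConst m r * ∑ x ∈ endpoints E, (x : ℝ)⁻¹) :=
        mul_le_mul_of_nonneg_left (sum_edgeWeight_overlap_le hE) (edgeWeight_nonneg E)

theorem sum_slotNeighbours_le (m r n : ℕ) :
    ∑ E ∈ cycleSets m r n,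
      (∑ F ∈ slotNeighbours m r n E,
        (choiceMeasure m n).real (presentEvent n E) * (choiceMeasure m n).real (presentEvent n F) +
      ∑ F ∈ (slotNeighbours m r n E).erase E,
        (choiceMeasure m n).real (presentEvent n E ∩ presentEvent n F)) ≤
      4 * cycleConst m r ^ 2 := by
  have hC := cycleConst_nonneg m r
  have hsq : ∑ x ∈ Finset.Icc 1 n, (x : ℝ)⁻¹ * (x : ℝ)⁻¹ ≤ 2 :=
    (Finset.sum_congr rfl fun x _ => by rw [← mul_inv, sq]).trans_le (sum_inv_sq_le_two n)
  calc _ ≤ ∑ E ∈ cycleSets m r n,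
        (edgeWeight E * (cycleConst m r * ∑ x ∈ endpoints E, (x : ℝ)⁻¹) +
          edgeWeight E * (cycleConst m r * ∑ x ∈ endpoints E, (x : ℝ)⁻¹)) :=
        Finset.sum_le_sum fun E hE => add_le_add (sum_mul_measureReal_slotNeighbours_le hE)
          (sum_measureReal_inter_slotNeighbours_le hE)
    _ = 2 * cycleConst m r *
          ∑ E ∈ cycleSets m r n, edgeWeight E * ∑ x ∈ endpoints E, (x : ℝ)⁻¹ := by
        rw [Finset.mul_sum]
        exact Finset.sum_congr rfl fun E _ => by ring
    _ ≤ 2 * cycleConst m r *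
          (cycleConst m r * ∑ x ∈ Finset.Icc 1 n, (x : ℝ)⁻¹ * (x : ℝ)⁻¹) := by
        gcongr
        exact sum_edgeWeight_mul_sum_endpoints_le m r n fun x => by positivity
    _ ≤ 2 * cycleConst m r * (cycleConst m r * 2) := by gcongr
    _ = 4 * cycleConst m r ^ 2 := by ring

theorem tvDist_nonneg (ν₁ ν₂ : Measure ℕ) : 0 ≤ tvDist ν₁ ν₂ :=
  Real.iSup_nonneg fun _ => abs_nonneg _

theorem tvDist_cycleLaw_succ_poisson_le (hpos : 0 < cycleMean m (r + 1) n) :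
    tvDist (cycleLaw m (r + 1) n)
        (poissonMeasure ⟨cycleMean m (r + 1) n, cycleMean_nonneg m (r + 1) n⟩) ≤
      4 * cycleConst m r ^ 2 * (cycleMean m (r + 1) n)⁻¹ := by
  refine ciSup_le fun A => ?_
  have hself (E) (hE : E ∈ cycleSets m r n) : E ∈ slotNeighbours m r n E := by
    refine Finset.mem_filter.2 ⟨hE, ?_⟩
    rw [disjoint_self, Finset.bot_eq_empty, Finset.image_eq_empty, ← Finset.card_eq_zero,
      card_of_mem_cycleSets hE]
    exact r.succ_ne_zero
  have hindep (E) (_ : E ∈ cycleSets m r n) :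
      IndepFun ((presentEvent n E).indicator (1 : Choices m n → ℕ))
        (eventCount (presentEvent n) (cycleSets m r n \ slotNeighbours m r n E))
        (choiceMeasure m n) := by
    refine indepFun_presentEvent_eventCount fun F hF => ?_
    obtain ⟨hF, hshare⟩ := Finset.mem_sdiff.1 hF
    by_contra h
    exact hshare (Finset.mem_filter.2 ⟨hF, h⟩)
  have hstein := abs_measureReal_eventCount_sub_poisson_real_le
    (r := ⟨cycleMean m (r + 1) n, cycleMean_nonneg m (r + 1) n⟩) (fun _ => .of_discrete)
    (fun E _ => Finset.filter_subset _ _) hself hindep hpos (cycleMean_succ_eq_sum m r n) A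
  rw [cycleLaw, map_measureReal_apply (measurable_cycleCount _ _ _) .of_discrete,
    cycleCount_succ_eq_eventCount, mul_comm, ← one_div]
  exact hstein.trans (mul_le_mul_of_nonneg_left (sum_slotNeighbours_le m r n)
    (one_div_nonneg.2 hpos.le))

theorem isTheta_cycleMean_succ_log (hm : 2 ≤ m) (hr : 1 ≤ r) :
    (fun n : ℕ => cycleMean m (r + 1) n) =Θ[atTop] fun n : ℕ => Real.log n := by
  have hlog : Tendsto (fun n : ℕ => Real.log n) atTop atTop :=
    Real.tendsto_log_atTop.comp tendsto_natCast_atTop_atTop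
  have hconst (a : ℝ) : (fun _ : ℕ => a) =o[atTop] fun n : ℕ => Real.log n :=
    isLittleO_const_left.2 (.inr (tendsto_norm_atTop_atTop.comp hlog))
  constructor
  · have hle : (fun n : ℕ => cycleMean m (r + 1) n) =O[atTop]
        fun n : ℕ => cycleConst m r * (1 + Real.log n) := .of_norm_le fun n => by
      rw [Real.norm_of_nonneg (cycleMean_nonneg ..)]
      exact cycleMean_succ_le m r n
    exact hle.trans (((hconst 1).isBigO.add (isBigO_refl _ _)).const_mul_left _)
  · have hge : (fun n : ℕ => Real.log n - 2 * r) =O[atTop] fun n => cycleMean m (r + 1) n := by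
      refine .of_bound (2 ^ r * r.factorial) ?_
      filter_upwards [hlog.eventually_ge_atTop (2 * r)] with n hn
      rw [Real.norm_of_nonneg (sub_nonneg.2 hn), Real.norm_of_nonneg (cycleMean_nonneg ..),
        ← inv_mul_le_iff₀ (by positivity)]
      exact log_sub_le_cycleMean_succ hm hr n
    exact (hconst (2 * r)).right_isBigO_sub.trans hge

theorem isBigO_tvDist_cycleLaw_succ_poisson (hm : 2 ≤ m) (hr : 1 ≤ r) :
    (fun n => tvDist (cycleLaw m (r + 1) n)
      (poissonMeasure ⟨cycleMean m (r + 1) n, cycleMean_nonneg m (r + 1) n⟩)) =O[atTop]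
      fun n : ℕ => (Real.log n)⁻¹ := by
  have hmean := isTheta_cycleMean_succ_log hm hr
  refine IsBigO.trans (.of_bound (4 * cycleConst m r ^ 2) ?_) hmean.inv.isBigO
  filter_upwards [hmean.eq_zero_iff, eventually_ge_atTop 2] with n hn hn2
  have hlog : Real.log n ≠ 0 := (Real.log_pos (by exact_mod_cast hn2)).ne'
  have hpos := (cycleMean_nonneg m (r + 1) n).lt_of_ne' (mt hn.1 hlog)
  rw [Real.norm_of_nonneg (tvDist_nonneg ..), Real.norm_of_nonneg (inv_nonneg.2 hpos.le)]
  exact tvDist_cycleLaw_succ_poisson_le hpos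

end PoissonApproximation

end UniformAttachment

theorem theorem3p1 (m ℓ : ℕ) (hm : 2 ≤ m) (hℓ : 2 ≤ ℓ) :
    (fun n : ℕ => UniformAttachment.cycleMean m ℓ n) =Θ[atTop] (fun n : ℕ => Real.log n) ∧
    ∃ C : ℝ, 0 < C ∧ ∀ n : ℕ, 2 ≤ n →
      UniformAttachment.tvDist (UniformAttachment.cycleLaw m ℓ n)
        (poissonMeasure ⟨UniformAttachment.cycleMean m ℓ n,
          UniformAttachment.cycleMean_nonneg m ℓ n⟩) ≤ C / Real.log n := by
  obtain ⟨r, rfl⟩ : ∃ r, ℓ = r + 1 := ⟨ℓ - 1, by lia⟩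
  have hr : 1 ≤ r := by lia
  obtain ⟨C, hC, hbound⟩ := bound_of_isBigO_nat_atTop
    (UniformAttachment.isBigO_tvDist_cycleLaw_succ_poisson hm hr)
  refine ⟨UniformAttachment.isTheta_cycleMean_succ_log hm hr, C, hC, fun n hn => ?_⟩
  have hlog : 0 < (Real.log n)⁻¹ := inv_pos.2 (Real.log_pos (by exact_mod_cast hn))
  rw [div_eq_mul_inv, ← Real.norm_of_nonneg hlog.le]
  exact (Real.le_norm_self _).trans (hbound hlog.ne')
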